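/- Let $(\Lambda,d)$ be a $k$-graph: a countable category (with morphisms, called paths, composed from right to left; $r$ and $s$ denote codomain and domain, and objects, called vertices, are identified with identity morphisms) together with a functor $d:\Lambda\to\mathbb N^k$ such that whenever $d(\lambda)=m+n$ there are unique $\mu,\nu$ with $\lambda=\mu\nu$, $d(\mu)=m$, $d(\nu)=n$. Write $e_1,\dots,e_k$ for the generators of $\mathbb N^k$, $\Lambda^n=d^{-1}(n)$, and $v\Lambda^n=\{\lambda\in\Lambda^n: r(\lambda)=v\}$. Assume that $\Lambda$ is row-finite (every $v\Lambda^n$ is finite) and locally convex (if $e\in\Lambda^{e_i}$, $j\neq i$ and $s(e)\Lambda^{e_j}=\emptyset$, then $r(e)\Lambda^{e_j}=\emptyset$). Let $\Lambda^{\le n}$ be the set of paths $\lambda$ with $d(\lambda)\le n$ such that $r(\mu)=s(\lambda)$ and $d(\lambda\mu)\le n$ imply $\mu=s(\lambda)$, and let $v\Lambda^{\le n}$ be the set of those with range $v$. Let $C^*(\Lambda)$ be the universal $C^*$-algebra generated by a Cuntz--Krieger $\Lambda$-family, i.e. by partial isometries $\{s_\lambda:\lambda\in\Lambda\}$ such that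 the $p_v:=s_v$ ($v\in\Lambda^0$) are mutually orthogonal projections, $s_\mu s_\nu=s_{\mu\nu}$ if $s(\mu)=r(\nu)$, $s_\lambda^*s_\lambda=p_{s(\lambda)}$, and $p_v=\sum_{\lambda\in v\Lambda^{\le n}}s_\lambda s_\lambda^*$ for all $v\in\Lambda^0$ and $n\in\mathbb N^k$. Let $\gamma$ be the gauge action of $\mathbb T^k$ on $C^*(\Lambda)$, determined by $\gamma_z(s_\lambda)=z^{d(\lambda)}s_\lambda$, and let $\Phi(a)=\int_{\mathbb T^k}\gamma_z(a)\,dz$ (normalised Haar measure). A trace on a $C^*$-algebra $A$ is a map $\tau:A^+\to[0,\infty]$ that is additive, satisfies $\tau(ta)=t\tau(a)$ for $t\ge0$ (with $0\cdot\infty=0$), and satisfies $\tau(a^*a)=\tau(aa^*)$ for all $a\in A$. It is faithful if $\tau(a^*a)=0$ implies $a=0$; semifinite if $\{a\in A^+:\tau(a)<\infty\}$ is norm dense in $A^+$; lower semicontinuous if $\tau(a)\le\liminf_n\tau(a_n)$ whenever $a_n\to a$ in norm in $A^+$. A trace extends by linearity to a linear functional, again denoted $\tau$, on the linear span $I_\tau$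 of $\{a\in A^+:\tau(a)<\infty\}$. A trace on $C^*(\Lambda)$ is gauge-invariant if $\tau(\gamma_z(a))=\tau(a)$ for all $z\in\mathbb T^k$ and $a\in C^*(\Lambda)^+$. A loop with an entrance is a path $\lambda$ with $r(\lambda)=s(\lambda)$ and $d(\lambda)\ge e_i$ for some $i$, together with an $e\in\Lambda^{e_i}$ such that $r(e)=r(\lambda)$ and $e\ne\lambda(0,e_i)$, where $\lambda(0,e_i)$ is the path of degree $e_i$ with $\lambda=\lambda(0,e_i)\lambda'$ for some $\lambda'$. (i) If $C^*(\Lambda)$ has a faithful semifinite trace, then no loop in $\Lambda$ has an entrance. (ii) Let $\tau$ be a gauge-invariant, semifinite, lower semicontinuous trace on $C^*(\Lambda)$. Then $\tau(\Phi(a))=\tau(a)$ for all $a\in C^*(\Lambda)^+$, and for all $\mu,\nu\in\Lambda$ the elements $s_\mu s_\nu^*$ and $p_{s(\mu)}$ belong to $I_\tau$ and $$\tau(s_\mu s_\nu^*)=\delta_{\mu,\nu}\,\tau(p_{s(\mu)}).$$ In particular, if $\tau$ vanishes on the positive elements of the $C^*$-subalgebra generated by $\{s_\mu s_\mu^*:\mu\in\Lambda\}$,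 then $\tau=0$. -/

import Mathlib

open CategoryTheory Filter Topology MeasureTheory
open scoped ENNReal NNReal

universe u v w

noncomputable section

/-! ## Traces on C⋆-algebras -/

/-- A trace on a C⋆-algebra `A`: an additive, positively homogeneous map from the cone
`A⁺ = {a // 0 ≤ a}` of positive elements to `[0, ∞]` with `τ (a⋆ a) = τ (a a⋆)`
(the convention `0 * ∞ = 0` is that of `ℝ≥0∞`). -/
structure CStarTrace (A : Type w) [NonUnitalCStarAlgebra A] [PartialOrder A]
    [StarOrderedRing A] where
  toFun : {a : A // 0 ≤ a} → ℝ≥0∞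
  map_add' : ∀ a b : {a : A // 0 ≤ a},
    toFun ⟨(a : A) + b, add_nonneg a.2 b.2⟩ = toFun a + toFun b
  map_smul' : ∀ (c : ℝ≥0) (a : {a : A // 0 ≤ a}),
    toFun ⟨(c : ℝ) • (a : A), smul_nonneg c.2 a.2⟩ = (c : ℝ≥0∞) * toFun a
  map_star_mul' : ∀ a : A,
    toFun ⟨star a * a, star_mul_self_nonneg a⟩ = toFun ⟨a * star a, mul_star_self_nonneg a⟩

namespace CStarTrace

variable {A : Type w} [NonUnitalCStarAlgebra A] [PartialOrder A] [StarOrderedRing A]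

instance : CoeFun (CStarTrace A) (fun _ => {a : A // 0 ≤ a} → ℝ≥0∞) := ⟨CStarTrace.toFun⟩

/-- `τ` is faithful if `τ (a⋆ a) = 0` implies `a = 0`. -/
def IsFaithful (τ : CStarTrace A) : Prop :=
  ∀ a : A, τ ⟨star a * a, star_mul_self_nonneg a⟩ = 0 → a = 0

/-- `τ` is semifinite (densely defined) if `{a ∈ A⁺ : τ a < ∞}` is norm dense in `A⁺`. -/
def IsSemifinite (τ : CStarTrace A) : Prop :=
  Dense {a : {a : A // 0 ≤ a} | τ a < ∞}

/-- `τ` is lower semicontinuous: `τ a ≤ liminf τ (a_n)` whenever `a_n → a` in norm in `A⁺`. -/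
def IsLowerSemicontinuous (τ : CStarTrace A) : Prop :=
  ∀ (x : ℕ → {a : A // 0 ≤ a}) (a : {a : A // 0 ≤ a}),
    Tendsto x atTop (𝓝 a) → τ a ≤ liminf (fun n => τ (x n)) atTop

/-- The complex linear span in `A × ℂ` of the pairs `(a, τ a)` with `a` positive and
`τ a` finite. -/
def graphSpan (τ : CStarTrace A) : Submodule ℂ (A × ℂ) :=
  Submodule.span ℂ
    {x | ∃ a : {a : A // 0 ≤ a}, τ a < ∞ ∧ x = ((a : A), (((τ a).toReal : ℝ) : ℂ))}

/-- The extension of `τ` by linearity to a (partially defined) linear functional on `A`. Its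
domain is the linear span `I_τ` of the positive elements of finite trace; see `extend_domain` and
`extend_coe`. -/
def extend (τ : CStarTrace A) : A →ₗ.[ℂ] ℂ := τ.graphSpan.toLinearPMap

theorem map_zero (τ : CStarTrace A) : τ ⟨0, le_rfl⟩ = 0 := by
  have h := τ.map_smul' 0 ⟨0, le_rfl⟩
  simpa using h

/-- `x = (a - b) + i (c - d)` with `a, b, c, d` positive of finite trace, together with the value
that linearity assigns to it. -/
def HasDecomp (τ : CStarTrace A) (x : A × ℂ) : Prop :=
  ∃ a b c d : {a : A // 0 ≤ a}, τ a < ∞ ∧ τ b < ∞ ∧ τ c < ∞ ∧ τ d < ∞ ∧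
    x.1 = ((a : A) - b) + Complex.I • ((c : A) - d) ∧
    x.2 = (((τ a).toReal : ℂ) - (τ b).toReal) +
      Complex.I * (((τ c).toReal : ℂ) - (τ d).toReal)

theorem HasDecomp.add {τ : CStarTrace A} {x y : A × ℂ} (hx : τ.HasDecomp x)
    (hy : τ.HasDecomp y) : τ.HasDecomp (x + y) := by
  obtain ⟨a, b, c, d, ha, hb, hc, hd, h1, h2⟩ := hx
  obtain ⟨a', b', c', d', ha', hb', hc', hd', h1', h2'⟩ := hy
  refine ⟨⟨(a : A) + a', add_nonneg a.2 a'.2⟩, ⟨(b : A) + b', add_nonneg b.2 b'.2⟩,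
    ⟨(c : A) + c', add_nonneg c.2 c'.2⟩, ⟨(d : A) + d', add_nonneg d.2 d'.2⟩, ?_, ?_, ?_, ?_,
    ?_, ?_⟩
  · rw [τ.map_add']; exact ENNReal.add_lt_top.2 ⟨ha, ha'⟩
  · rw [τ.map_add']; exact ENNReal.add_lt_top.2 ⟨hb, hb'⟩
  · rw [τ.map_add']; exact ENNReal.add_lt_top.2 ⟨hc, hc'⟩
  · rw [τ.map_add']; exact ENNReal.add_lt_top.2 ⟨hd, hd'⟩
  · rw [Prod.fst_add, h1, h1']
    simp only [smul_sub, smul_add]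
    abel
  · rw [Prod.snd_add, h2, h2', τ.map_add', τ.map_add', τ.map_add', τ.map_add',
      ENNReal.toReal_add ha.ne ha'.ne, ENNReal.toReal_add hb.ne hb'.ne,
      ENNReal.toReal_add hc.ne hc'.ne, ENNReal.toReal_add hd.ne hd'.ne]
    push_cast
    ring

theorem HasDecomp.neg {τ : CStarTrace A} {x : A × ℂ} (hx : τ.HasDecomp x) :
    τ.HasDecomp (-x) := by
  obtain ⟨a, b, c, d, ha, hb, hc, hd, h1, h2⟩ := hx
  refine ⟨b, a, d, c, hb, ha, hd, hc, ?_, ?_⟩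
  · rw [Prod.fst_neg, h1]
    simp only [smul_sub]
    abel
  · rw [Prod.snd_neg, h2]
    ring

theorem HasDecomp.I_smul {τ : CStarTrace A} {x : A × ℂ} (hx : τ.HasDecomp x) :
    τ.HasDecomp (Complex.I • x) := by
  obtain ⟨a, b, c, d, ha, hb, hc, hd, h1, h2⟩ := hx
  refine ⟨d, c, a, b, hd, hc, ha, hb, ?_, ?_⟩
  · rw [Prod.smul_fst, h1, smul_add, smul_smul, Complex.I_mul_I, neg_one_smul]
    abel
  · rw [Prod.smul_snd, h2, smul_eq_mul, mul_add, ← mul_assoc, Complex.I_mul_I]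
    ring

theorem HasDecomp.nnreal_smul {τ : CStarTrace A} {x : A × ℂ} (r : ℝ≥0) (hx : τ.HasDecomp x) :
    τ.HasDecomp (((r : ℝ) : ℂ) • x) := by
  obtain ⟨a, b, c, d, ha, hb, hc, hd, h1, h2⟩ := hx
  refine ⟨⟨(r : ℝ) • (a : A), smul_nonneg r.2 a.2⟩, ⟨(r : ℝ) • (b : A), smul_nonneg r.2 b.2⟩,
    ⟨(r : ℝ) • (c : A), smul_nonneg r.2 c.2⟩, ⟨(r : ℝ) • (d : A), smul_nonneg r.2 d.2⟩,
    ?_, ?_, ?_, ?_, ?_, ?_⟩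
  · rw [τ.map_smul']; exact ENNReal.mul_lt_top ENNReal.coe_lt_top ha
  · rw [τ.map_smul']; exact ENNReal.mul_lt_top ENNReal.coe_lt_top hb
  · rw [τ.map_smul']; exact ENNReal.mul_lt_top ENNReal.coe_lt_top hc
  · rw [τ.map_smul']; exact ENNReal.mul_lt_top ENNReal.coe_lt_top hd
  · rw [Prod.smul_fst, h1, smul_add, smul_comm _ Complex.I, Complex.coe_smul, Complex.coe_smul,
      smul_sub, smul_sub]
  · rw [Prod.smul_snd, h2, smul_eq_mul, τ.map_smul', τ.map_smul', τ.map_smul', τ.map_smul']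
    simp only [ENNReal.toReal_mul, ENNReal.coe_toReal]
    push_cast
    ring

theorem HasDecomp.real_smul {τ : CStarTrace A} {x : A × ℂ} (r : ℝ) (hx : τ.HasDecomp x) :
    τ.HasDecomp ((r : ℂ) • x) := by
  rcases le_total 0 r with hr | hr
  · exact hx.nnreal_smul ⟨r, hr⟩
  · have h' := (hx.nnreal_smul ⟨-r, neg_nonneg.2 hr⟩).neg
    have e : -((((⟨-r, neg_nonneg.2 hr⟩ : ℝ≥0) : ℝ) : ℂ) • x) = (r : ℂ) • x := by
      rw [← neg_smul]
      congr 1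
      simp
    exact e ▸ h'

theorem hasDecomp_of_mem_graphSpan (τ : CStarTrace A) {x : A × ℂ} (hx : x ∈ τ.graphSpan) :
    τ.HasDecomp x := by
  have hzero : τ ⟨0, le_rfl⟩ < ∞ := by rw [τ.map_zero]; exact ENNReal.zero_lt_top
  induction hx using Submodule.span_induction with
  | mem x hx =>
    obtain ⟨a, ha, rfl⟩ := hx
    refine ⟨a, ⟨0, le_rfl⟩, ⟨0, le_rfl⟩, ⟨0, le_rfl⟩, ha, hzero, hzero, hzero, ?_, ?_⟩
    · simp
    · simp [τ.map_zero]
  | zero =>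
    refine ⟨⟨0, le_rfl⟩, ⟨0, le_rfl⟩, ⟨0, le_rfl⟩, ⟨0, le_rfl⟩, hzero, hzero, hzero, hzero, ?_, ?_⟩
    · simp
    · simp
  | add x y _ _ hx hy => exact hx.add hy
  | smul z x _ hx =>
    have h := (hx.real_smul z.re).add (hx.real_smul z.im).I_smul
    have e : (z.re : ℂ) • x + Complex.I • (z.im : ℂ) • x = z • x := by
      rw [smul_smul, ← add_smul, mul_comm, Complex.re_add_im]
    rwa [e] at h

theorem snd_eq_zero_of_mem_graphSpan (τ : CStarTrace A) (x : A × ℂ) (hx : x ∈ τ.graphSpan)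
    (h0 : x.fst = 0) : x.snd = 0 := by
  obtain ⟨a, b, c, d, ha, hb, hc, hd, h1, h2⟩ := τ.hasDecomp_of_mem_graphSpan hx
  rw [h0] at h1
  have hs : (0 : A) = ((a : A) - b) - Complex.I • ((c : A) - d) := by
    have h3 := congrArg star h1
    simp only [star_zero, star_add, star_sub, star_smul, a.2.star_eq, b.2.star_eq,
      c.2.star_eq, d.2.star_eq] at h3
    refine h3.trans ?_
    rw [Complex.star_def, Complex.conj_I, neg_smul, ← sub_eq_add_neg]
  have hab : (a : A) = b := by
    have h4 : (0 : A) = (2 : ℂ) • ((a : A) - b) := by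
      calc (0 : A) = 0 + 0 := by simp
        _ = (((a : A) - b) + Complex.I • ((c : A) - d)) +
            (((a : A) - b) - Complex.I • ((c : A) - d)) := congrArg₂ (· + ·) h1 hs
        _ = (2 : ℂ) • ((a : A) - b) := by rw [two_smul]; abel
    exact sub_eq_zero.1 ((smul_eq_zero.1 h4.symm).resolve_left two_ne_zero)
  have hcd : (c : A) = d := by
    rw [hab, sub_self, zero_add] at h1
    exact sub_eq_zero.1 ((smul_eq_zero.1 h1.symm).resolve_left Complex.I_ne_zero)
  have hab' : a = b := Subtype.ext hab
  have hcd' : c = d := Subtype.ext hcd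
  rw [h2, hab', hcd']
  simp

/-- The domain `I_τ` of the extended trace. -/
theorem extend_domain (τ : CStarTrace A) :
    τ.extend.domain = Submodule.span ℂ {x : A | ∃ h : 0 ≤ x, τ ⟨x, h⟩ < ∞} := by
  rw [extend, Submodule.toLinearPMap_domain, graphSpan, Submodule.map_span]
  congr 1
  ext x
  constructor
  · rintro ⟨_, ⟨a, ha, rfl⟩, rfl⟩
    exact ⟨a.2, ha⟩
  · rintro ⟨h, hx⟩
    exact ⟨_, ⟨⟨x, h⟩, hx, rfl⟩, rfl⟩

/-- The extended trace agrees with `τ` on positive elements of finite trace. -/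
theorem extend_coe (τ : CStarTrace A) (a : {a : A // 0 ≤ a}) (ha : τ a < ∞) :
    ∃ h : (a : A) ∈ τ.extend.domain, τ.extend ⟨a, h⟩ = (((τ a).toReal : ℝ) : ℂ) := by
  have hmem : ((a : A), (((τ a).toReal : ℝ) : ℂ)) ∈ τ.extend.graph := by
    rw [extend, Submodule.toLinearPMap_graph_eq _ τ.snd_eq_zero_of_mem_graphSpan]
    exact Submodule.subset_span ⟨a, ha, rfl⟩
  obtain ⟨y, hy1, hy2⟩ := (LinearPMap.mem_graph_iff _).1 hmem
  have hy : (y : A) = a := hy1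
  have hmem' : (a : A) ∈ τ.extend.domain := hy ▸ y.2
  have hya : y = ⟨(a : A), hmem'⟩ := Subtype.ext hy
  exact ⟨hmem', hya ▸ hy2⟩

end CStarTrace

/-! ## Higher-rank graphs -/

/-- The structure of a `k`-graph on a category with object set `V`: there are countably many
morphisms, and there is a degree functor to the monoid `ℕ^k` with the factorisation property.

Morphisms are called paths. The source `s(f)` and range `r(f)` of `f : a ⟶ b` are its domain `a`
and its codomain `b`, and the composite written `μν` (first `ν`, then `μ`) is `ν ≫ μ`. Vertices
are identified with identity morphisms. -/
structure KGraph (k : ℕ) (V : Type u) [Category.{v} V] where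
  countable_paths : Countable (Σ (a b : V), a ⟶ b)
  deg : ∀ {a b : V}, (a ⟶ b) → (Fin k → ℕ)
  deg_id : ∀ a : V, deg (𝟙 a) = 0
  deg_comp : ∀ {a b c : V} (ν : a ⟶ b) (μ : b ⟶ c), deg (ν ≫ μ) = deg μ + deg ν
  factorisation : ∀ {a b : V} (f : a ⟶ b) (m n : Fin k → ℕ), deg f = m + n →
    ∃! p : Σ c : V, (a ⟶ c) × (c ⟶ b),
      deg p.2.2 = m ∧ deg p.2.1 = n ∧ p.2.1 ≫ p.2.2 = f

namespace KGraph

variable {k : ℕ} {V : Type u} [Category.{v} V] (Λ : KGraph k V)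

/-- The set of all paths of `Λ`. -/
abbrev Path (_ : KGraph k V) : Type (max u v) := Σ (a b : V), a ⟶ b

/-- The set `vΛ` of paths with range `x`. -/
abbrev PathsTo (_ : KGraph k V) (x : V) : Type (max u v) := Σ a : V, a ⟶ x

/-- The generator `e_i` of `ℕ^k`. -/
abbrev basisVec (i : Fin k) : Fin k → ℕ := Pi.single i 1

/-- `Λ` is row-finite: `vΛ^n` is finite for every vertex `v` and every `n ∈ ℕ^k`. -/
def RowFinite : Prop :=
  ∀ (x : V) (n : Fin k → ℕ), {p : Λ.PathsTo x | Λ.deg p.2 = n}.Finite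

/-- `Λ` is locally convex: for each edge `e` of degree `e_i` and each `j ≠ i`, the set
`s(e)Λ^{e_j}` is empty only if `r(e)Λ^{e_j}` is empty. -/
def LocallyConvex : Prop :=
  ∀ {a b : V} (e : a ⟶ b) (i j : Fin k), Λ.deg e = basisVec i → j ≠ i →
    {p : Λ.PathsTo a | Λ.deg p.2 = basisVec j} = ∅ →
    {p : Λ.PathsTo b | Λ.deg p.2 = basisVec j} = ∅

/-- The set `vΛ^{≤ n}`: paths `p` with range `x` and `d(p) ≤ n` such that `μ ∈ s(p)Λ` and
`d(pμ) ≤ n` imply `μ = s(p)`. -/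
def pathsLE (x : V) (n : Fin k → ℕ) : Set (Λ.PathsTo x) :=
  {p | Λ.deg p.2 ≤ n ∧
    ∀ q : Λ.PathsTo p.1, Λ.deg (q.2 ≫ p.2) ≤ n → q = ⟨p.1, 𝟙 p.1⟩}

theorem pathsLE_finite (h : Λ.RowFinite) (x : V) (n : Fin k → ℕ) : (Λ.pathsLE x n).Finite := by
  refine ((Set.finite_Iic n).biUnion fun m _ => h x m).subset fun p hp => ?_
  exact Set.mem_biUnion (show Λ.deg p.2 ∈ Set.Iic n from hp.1) rfl

/-- The closed path `f` (a loop when its degree is nonzero) has an entrance: for some `i` with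
`d(f) ≥ e_i` there is an edge `e` of degree `e_i` with `r(e) = r(f)` and `f(0, e_i) ≠ e`. Here the
initial segment `f(0, e_i)` is the path `α` of degree `e_i` in the factorisation `f = αβ`. -/
def HasEntrance {x : V} (f : x ⟶ x) : Prop :=
  ∃ i : Fin k, basisVec i ≤ Λ.deg f ∧ ∃ e : Λ.PathsTo x, Λ.deg e.2 = basisVec i ∧
    ∃ (α : Λ.PathsTo x) (β : x ⟶ α.1), Λ.deg α.2 = basisVec i ∧ β ≫ α.2 = f ∧ α ≠ e

/-! ## Cuntz–Krieger families and `C⋆(Λ)` -/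

/-- A Cuntz–Krieger `Λ`-family in a C⋆-algebra `B`, for row-finite `Λ` (so that the sum in
`ck4` is over a finite set, see `pathsLE_finite`). -/
structure CKFamily (B : Type w) [NonUnitalCStarAlgebra B] where
  s : ∀ {a b : V}, (a ⟶ b) → B
  partialIsometry : ∀ {a b : V} (f : a ⟶ b), s f * star (s f) * s f = s f
  ck1_proj : ∀ x : V, IsStarProjection (s (𝟙 x))
  ck1_orth : ∀ x y : V, x ≠ y → s (𝟙 x) * s (𝟙 y) = 0
  ck2 : ∀ {a b c : V} (ν : a ⟶ b) (μ : b ⟶ c), s μ * s ν = s (ν ≫ μ)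
  ck3 : ∀ {a b : V} (f : a ⟶ b), star (s f) * s f = s (𝟙 a)
  ck4 : ∀ (x : V) (n : Fin k → ℕ),
    s (𝟙 x) = ∑ᶠ p ∈ Λ.pathsLE x n, s p.2 * star (s p.2)

/-- A Cuntz–Krieger `Λ`-family together with the C⋆-algebra that contains it. -/
structure CKRep where
  alg : Type (max u v)
  [inst : NonUnitalCStarAlgebra alg]
  fam : Λ.CKFamily alg

attribute [instance] CKRep.inst

variable {Λ}

theorem CKFamily.norm_le_one {B : Type w} [NonUnitalCStarAlgebra B] (t : Λ.CKFamily B)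
    {a b : V} (f : a ⟶ b) : ‖t.s f‖ ≤ 1 := by
  have hp := t.ck1_proj a
  have h1 : ‖t.s (𝟙 a)‖ * ‖t.s (𝟙 a)‖ = ‖t.s (𝟙 a)‖ := by
    rw [← CStarRing.norm_star_mul_self, hp.isSelfAdjoint.star_eq, hp.isIdempotentElem.eq]
  have h2 : ‖t.s f‖ * ‖t.s f‖ = ‖t.s (𝟙 a)‖ := by
    rw [← CStarRing.norm_star_mul_self, t.ck3]
  have h3 : ‖t.s (𝟙 a)‖ ≤ 1 := by
    by_contra! h
    nlinarith
  by_contra! h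
  nlinarith

variable (Λ)

/-- The C⋆-algebra of bounded functions that send each Cuntz–Krieger family to an element of the
C⋆-algebra containing the family. -/
abbrev BigAlg : Type (max u v + 1) := lp (fun t : Λ.CKRep => t.alg) ∞

/-- The function which sends each Cuntz–Krieger family `t` to its member `t_f`. -/
def bigGen {a b : V} (f : a ⟶ b) : Λ.BigAlg :=
  ⟨fun t => t.fam.s f, memℓp_infty ⟨1, by rintro _ ⟨t, rfl⟩; exact t.fam.norm_le_one f⟩⟩

/-- The C⋆-subalgebra of `BigAlg` generated by the elements `bigGen f`. -/
def algSub : NonUnitalStarSubalgebra ℂ Λ.BigAlg :=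
  (NonUnitalStarAlgebra.adjoin ℂ (Set.range fun f : Λ.Path => Λ.bigGen f.2.2)).topologicalClosure

theorem isClosed_algSub : IsClosed (Λ.algSub : Set Λ.BigAlg) :=
  NonUnitalStarSubalgebra.isClosed_topologicalClosure _

/-- `C⋆(Λ)`, the universal C⋆-algebra generated by a Cuntz–Krieger `Λ`-family. It is the
C⋆-algebra generated by the direct sum of all Cuntz–Krieger families, hence the evaluation at a
family `t` is the homomorphism `π_t` of the universal property (see `lift`). Families in algebras in
one universe suffice: since `Λ` is countable, the C⋆-algebra generated by a family is separable, so
that it has an isomorphic copy in any universe. -/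
def CStar : Type (max u v + 1) := Λ.algSub

instance : NonUnitalCStarAlgebra Λ.CStar :=
  NonUnitalStarSubalgebra.nonUnitalCStarAlgebra Λ.algSub (h_closed := Λ.isClosed_algSub)

/-- The usual order of a C⋆-algebra, whose positive elements are the elements `b⋆ b`. -/
instance : PartialOrder Λ.CStar := CStarAlgebra.spectralOrder _

instance : StarOrderedRing Λ.CStar := CStarAlgebra.spectralOrderedRing _

/-- The generator `s_f` of `C⋆(Λ)`. -/
def gen {a b : V} (f : a ⟶ b) : Λ.CStar :=
  ⟨Λ.bigGen f, NonUnitalStarSubalgebra.le_topologicalClosure _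
    (NonUnitalStarAlgebra.subset_adjoin ℂ _ ⟨⟨a, b, f⟩, rfl⟩)⟩

/-- The vertex projection `p_x` of `C⋆(Λ)`. -/
def vertexProj (x : V) : Λ.CStar := Λ.gen (𝟙 x)

/-- The inclusion of `C⋆(Λ)` in `BigAlg`. -/
def incl : Λ.CStar →⋆ₙₐ[ℂ] Λ.BigAlg := NonUnitalStarSubalgebraClass.subtype Λ.algSub

/-- Evaluation of elements of `BigAlg` at a Cuntz–Krieger family. -/
def evalHom (t : Λ.CKRep) : Λ.BigAlg →⋆ₙₐ[ℂ] t.alg where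
  toFun x := x t
  map_smul' _ _ := rfl
  map_zero' := rfl
  map_add' _ _ := rfl
  map_mul' _ _ := rfl
  map_star' _ := rfl

/-- The homomorphism `π_t : C⋆(Λ) → B` given by a Cuntz–Krieger family `t` in `B`. -/
def lift {B : Type (max u v)} [NonUnitalCStarAlgebra B] (t : Λ.CKFamily B) : Λ.CStar →⋆ₙₐ[ℂ] B :=
  (Λ.evalHom ⟨B, t⟩).comp Λ.incl

theorem lift_gen {B : Type (max u v)} [NonUnitalCStarAlgebra B] (t : Λ.CKFamily B) {a b : V}
    (f : a ⟶ b) : Λ.lift t (Λ.gen f) = t.s f := rfl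

theorem isStarProjection_bigGen (x : V) : IsStarProjection (Λ.bigGen (𝟙 x)) where
  isIdempotentElem := lp.ext (funext fun t => (t.fam.ck1_proj x).isIdempotentElem)
  isSelfAdjoint := lp.ext (funext fun t => (t.fam.ck1_proj x).isSelfAdjoint)

theorem evalHom_injective {x y : Λ.BigAlg} (h : ∀ t : Λ.CKRep, Λ.evalHom t x = Λ.evalHom t y) :
    x = y := lp.ext (funext h)

/-- The generators of `C⋆(Λ)` form a Cuntz–Krieger family when `Λ` is row-finite. -/
def genFamily (h : Λ.RowFinite) : Λ.CKFamily Λ.CStar where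
  s := Λ.gen
  partialIsometry f := Subtype.ext (lp.ext (funext fun t => t.fam.partialIsometry f))
  ck1_proj x :=
    { isIdempotentElem := Subtype.ext (Λ.isStarProjection_bigGen x).isIdempotentElem
      isSelfAdjoint := Subtype.ext (Λ.isStarProjection_bigGen x).isSelfAdjoint }
  ck1_orth x y hxy := Subtype.ext (lp.ext (funext fun t => t.fam.ck1_orth x y hxy))
  ck2 ν μ := Subtype.ext (lp.ext (funext fun t => t.fam.ck2 ν μ))
  ck3 f := Subtype.ext (lp.ext (funext fun t => t.fam.ck3 f))
  ck4 x n := by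
    refine Subtype.ext (Λ.evalHom_injective fun t => ?_)
    change t.fam.s (𝟙 x) = (Λ.evalHom t).comp Λ.incl _
    rw [t.fam.ck4 x n, finsum_mem_eq_finite_toFinset_sum _ (Λ.pathsLE_finite h x n),
      finsum_mem_eq_finite_toFinset_sum _ (Λ.pathsLE_finite h x n), map_sum]
    rfl

/-! ## The gauge action and the expectation `Φ` -/

/-- `z^{d(f)} = ∏ i, z_i ^ d(f)_i`. -/
def torusPow (z : Fin k → Circle) {a b : V} (f : a ⟶ b) : Circle := ∏ i, z i ^ Λ.deg f i

variable {Λ}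

/-- The Cuntz–Krieger family `f ↦ z^{d(f)} t_f`. -/
def CKFamily.twist {B : Type w} [NonUnitalCStarAlgebra B] (t : Λ.CKFamily B)
    (z : Fin k → Circle) : Λ.CKFamily B :=
  have h1 : ∀ x : V, ((Λ.torusPow z (𝟙 x) : Circle) : ℂ) • t.s (𝟙 x) = t.s (𝟙 x) := fun x => by
    simp [torusPow, Λ.deg_id]
  have h2 : ∀ {a b : V} (f : a ⟶ b),
      ((Λ.torusPow z f : Circle) : ℂ) * star ((Λ.torusPow z f : Circle) : ℂ) = 1 := fun f => by
    rw [Complex.star_def, Complex.mul_conj, Circle.normSq_coe, Complex.ofReal_one]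
  { s := fun f => ((Λ.torusPow z f : Circle) : ℂ) • t.s f
    partialIsometry := fun f => by
      rw [star_smul, smul_mul_smul_comm, h2, one_smul, mul_smul_comm, t.partialIsometry]
    ck1_proj := fun x => by rw [h1]; exact t.ck1_proj x
    ck1_orth := fun x y hxy => by rw [h1, h1]; exact t.ck1_orth x y hxy
    ck2 := fun ν μ => by
      rw [smul_mul_smul_comm, t.ck2, ← Circle.coe_mul]
      congr 2
      simp only [torusPow, Λ.deg_comp, Pi.add_apply, pow_add, Finset.prod_mul_distrib]
      rfl
    ck3 := fun f => by
      rw [h1, star_smul, smul_mul_smul_comm, mul_comm, h2, one_smul, t.ck3]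
    ck4 := fun x n => by
      rw [h1, t.ck4 x n]
      refine finsum_congr fun p => finsum_congr fun _ => ?_
      rw [star_smul, smul_mul_smul_comm, h2, one_smul] }

variable (Λ)

/-- The family `t` of a representation, replaced by `f ↦ z^{d(f)} t_f`. -/
def CKRep.twist {Λ : KGraph k V} (t : Λ.CKRep) (z : Fin k → Circle) : Λ.CKRep :=
  ⟨t.alg, t.fam.twist z⟩

/-- The ⋆-endomorphism of `BigAlg` that sends `x` to the function `t ↦ x (z • t)`. -/
def bigGauge (z : Fin k → Circle) : Λ.BigAlg →⋆ₙₐ[ℂ] Λ.BigAlg where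
  toFun x := ⟨fun t => x (t.twist z), memℓp_infty ⟨‖x‖, by
    rintro _ ⟨t, rfl⟩
    exact lp.norm_apply_le_norm ENNReal.top_ne_zero x (t.twist z)⟩⟩
  map_smul' _ _ := rfl
  map_zero' := rfl
  map_add' _ _ := rfl
  map_mul' _ _ := rfl
  map_star' _ := rfl

theorem bigGauge_bigGen (z : Fin k → Circle) {a b : V} (f : a ⟶ b) :
    Λ.bigGauge z (Λ.bigGen f) = ((Λ.torusPow z f : Circle) : ℂ) • Λ.bigGen f := rfl

theorem bigGauge_mem (z : Fin k → Circle) {x : Λ.BigAlg} (hx : x ∈ Λ.algSub) :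
    Λ.bigGauge z x ∈ Λ.algSub := by
  have hcont : Continuous (Λ.bigGauge z) :=
    AddMonoidHomClass.continuous_of_bound (Λ.bigGauge z) 1 fun x => by
      simpa using NonUnitalStarAlgHom.norm_apply_le (Λ.bigGauge z) x
  have hclosed : IsClosed ((Λ.algSub.comap (Λ.bigGauge z) : NonUnitalStarSubalgebra ℂ Λ.BigAlg) :
      Set Λ.BigAlg) := Λ.isClosed_algSub.preimage hcont
  have hle : Λ.algSub ≤ Λ.algSub.comap (Λ.bigGauge z) := by
    refine NonUnitalStarSubalgebra.topologicalClosure_minimal _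
      (NonUnitalStarAlgebra.adjoin_le ?_) hclosed
    rintro _ ⟨f, rfl⟩
    change Λ.bigGauge z (Λ.bigGen f.2.2) ∈ Λ.algSub
    rw [bigGauge_bigGen]
    exact SMulMemClass.smul_mem _ (Λ.gen f.2.2).2
  exact hle hx

/-- The gauge action `γ_z` on `C⋆(Λ)`; it is determined by `γ_z (s_f) = z^{d(f)} s_f`, see
`gauge_gen`. -/
def gauge (z : Fin k → Circle) : Λ.CStar →⋆ₙₐ[ℂ] Λ.CStar :=
  NonUnitalStarAlgHom.codRestrict ((Λ.bigGauge z).comp Λ.incl) Λ.algSub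
    fun x => Λ.bigGauge_mem z x.2

theorem gauge_gen (z : Fin k → Circle) {a b : V} (f : a ⟶ b) :
    Λ.gauge z (Λ.gen f) = ((Λ.torusPow z f : Circle) : ℂ) • Λ.gen f := rfl

end KGraph

/-- The Borel σ-algebra of the unit circle. -/
instance circleMeasurableSpace : MeasurableSpace Circle := borel Circle

instance circleBorelSpace : BorelSpace Circle := ⟨rfl⟩

/-- Normalised Haar measure on the torus `𝕋^k`. -/
def torusHaar (k : ℕ) : Measure (Fin k → Circle) := Measure.haarMeasure ⊤

namespace KGraph

variable {k : ℕ} {V : Type u} [Category.{v} V] (Λ : KGraph k V)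

/-- `Φ(a) = ∫ γ_z(a) dz`, the conditional expectation onto the fixed point algebra of `γ`. -/
def Phi (a : Λ.CStar) : Λ.CStar := ∫ z, Λ.gauge z a ∂(torusHaar k)

theorem gauge_nonneg (z : Fin k → Circle) {a : Λ.CStar} (ha : 0 ≤ a) : 0 ≤ Λ.gauge z a :=
  map_nonneg (Λ.gauge z) ha

theorem Phi_nonneg {a : Λ.CStar} (ha : 0 ≤ a) : 0 ≤ Λ.Phi a :=
  integral_nonneg fun z => Λ.gauge_nonneg z ha

/-- `τ` is invariant under the gauge action. -/
def IsGaugeInvariant (τ : CStarTrace Λ.CStar) : Prop :=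
  ∀ (z : Fin k → Circle) (a : {a : Λ.CStar // 0 ≤ a}),
    τ ⟨Λ.gauge z a, Λ.gauge_nonneg z a.2⟩ = τ a

/-- The diagonal subalgebra `C⋆({s_f s_f⋆ : f ∈ Λ})` of `C⋆(Λ)`. -/
def diagonal : NonUnitalStarSubalgebra ℂ Λ.CStar :=
  (NonUnitalStarAlgebra.adjoin ℂ
    (Set.range fun f : Λ.Path => Λ.gen f.2.2 * star (Λ.gen f.2.2))).topologicalClosure

end KGraph

end

/-! Two facts about traces carry both parts. A semifinite trace is finite on every projection `p`:
some `a ≥ 0` of finite trace is within 1/2 of `p`, and then `p ≤ 2 pap`, while compression by `p`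
does not increase the trace (`IsSemifinite.apply_projection_lt_top`). Hence `a ↦ τ(pap)` extends to
an everywhere defined positive functional, which is automatically bounded
(`exists_corner_functional`).

(i) Let `f = αβ` be a loop at `x` with an entrance `e ≠ α`, where `d(α) = d(e) = e_i`. Then `τ(p_x)
= τ(s_f s_f⋆) ≤ τ(s_α s_α⋆)`, whereas `s_α s_α⋆ + s_e s_e⋆ ≤ p_x`. Since `τ(p_x)` is finite, `τ(s_e
s_e⋆) = 0`, so faithfulness kills `s_e` and with it `p_{s(e)}`. This is absurd once vertex
projections are known to be nonzero (`vertexProj_ne_zero`). For that a concrete Cuntz–Krieger family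
is built on `ℓ²` of the boundary paths, each described by its set of finite initial segments; local
convexity enters here.

(ii) For a finite set `F` of vertices let `p_F` be the sum of its vertex projections. The bounded
functional `a ↦ τ(p_F a p_F)` passes through the integral defining `Φ` and is gauge-invariant, so it
agrees on `a` and `Φ(a)`. As `p_F a p_F → a` and `τ(p_F a p_F) ≤ τ(a)`, lower semicontinuity gives
`τ ∘ Φ = τ` (`apply_Phi`). Polarization gives `τ(s_μ s_ν⋆) = τ(s_ν⋆ s_μ)`. This settles `μ = ν`, and
distinct paths of equal degree, where `s_ν⋆ s_μ = 0`. For different degrees, gauge invariance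
multiplies the value by a scalar other than 1 without changing it. Finally `τ(p_F a p_F) ≤ ‖a‖
τ(p_F)`, which is zero if `τ` vanishes on the diagonal. -/

noncomputable section

/-! ### Traces: projections, polarization and corners. -/

namespace CStarTrace

variable {A : Type w} [NonUnitalCStarAlgebra A] [PartialOrder A] [StarOrderedRing A]

theorem apply_congr (τ : CStarTrace A) {a b : A} (ha : 0 ≤ a) (hab : a = b) :
    τ ⟨a, ha⟩ = τ ⟨b, hab ▸ ha⟩ := by
  subst hab; rfl

theorem apply_add (τ : CStarTrace A) {a b : A} (ha : 0 ≤ a) (hb : 0 ≤ b) (hab : 0 ≤ a + b) :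
    τ ⟨a + b, hab⟩ = τ ⟨a, ha⟩ + τ ⟨b, hb⟩ :=
  τ.map_add' ⟨a, ha⟩ ⟨b, hb⟩

theorem apply_smul (τ : CStarTrace A) (c : ℝ≥0) {a : A} (ha : 0 ≤ a)
    (hca : 0 ≤ (c : ℝ) • a) : τ ⟨(c : ℝ) • a, hca⟩ = c * τ ⟨a, ha⟩ :=
  τ.map_smul' c ⟨a, ha⟩

theorem apply_mono (τ : CStarTrace A) {a b : A} (ha : 0 ≤ a) (hab : a ≤ b) :
    τ ⟨a, ha⟩ ≤ τ ⟨b, ha.trans hab⟩ := by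
  have h : τ ⟨b, ha.trans hab⟩ = τ ⟨a, ha⟩ + τ ⟨b - a, sub_nonneg.2 hab⟩ := by
    rw [← τ.apply_add ha (sub_nonneg.2 hab) (by simpa using ha.trans hab)]
    exact τ.apply_congr _ (by abel)
  rw [h]
  exact le_self_add

/-- Compression by a projection does not increase a trace. -/
theorem apply_conj_le (τ : CStarTrace A) {p a : A} (hp : IsStarProjection p) (ha : 0 ≤ a)
    (hpa : 0 ≤ p * a * p) : τ ⟨p * a * p, hpa⟩ ≤ τ ⟨a, ha⟩ := by
  -- In general `pap ≤ a` fails. With `a = b⋆b` the trace property replaces `pap = (bp)⋆(bp)` by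
  -- `bpb⋆`, which does lie below `bb⋆`.
  obtain ⟨b, rfl⟩ := CStarAlgebra.nonneg_iff_eq_star_mul_self.1 ha
  have hs : star p = p := hp.isSelfAdjoint.star_eq
  have hi : p * p = p := hp.isIdempotentElem.eq
  have h1 : p * (star b * b) * p = star (b * p) * (b * p) := by
    simp only [star_mul, hs, mul_assoc]
  have h2 : (b * p) * star (b * p) ≤ b * star b := by
    rw [← sub_nonneg]
    have : b * star b - (b * p) * star (b * p) = (b - b * p) * star (b - b * p) := by
      have : b * p * (p * star b) = b * p * star b := by
        rw [mul_assoc, ← mul_assoc p, hi, mul_assoc]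
      simp only [star_sub, star_mul, hs, sub_mul, mul_sub, this]
      rw [← mul_assoc b p]
      abel
    rw [this]
    exact mul_star_self_nonneg _
  rw [τ.apply_congr hpa h1, τ.map_star_mul', τ.map_star_mul']
  exact τ.apply_mono _ h2

/-- A semifinite trace is finite on projections. -/
theorem IsSemifinite.apply_projection_lt_top {τ : CStarTrace A} (h : τ.IsSemifinite) {p : A}
    (hp : IsStarProjection p) (hp0 : 0 ≤ p) : τ ⟨p, hp0⟩ < ∞ := by
  have hs : star p = p := hp.isSelfAdjoint.star_eq
  have hi : p * p = p := hp.isIdempotentElem.eq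
  -- Distance at most 1/2 gives `p - pap ≤ p/2`, hence `p ≤ 2 pap`; any constant below 1 would
  -- serve.
  obtain ⟨⟨a, ha⟩, hat, had⟩ := Metric.dense_iff.1 h ⟨p, hp0⟩ (1 / 2) (by norm_num)
  rw [Metric.mem_ball] at hat
  have hn : ‖p - a‖ ≤ 1 / 2 := by
    rw [← dist_eq_norm, dist_comm]; exact hat.le
  have hsa : IsSelfAdjoint (p - a) := hp.isSelfAdjoint.sub (IsSelfAdjoint.of_nonneg ha)
  have h1 := CStarAlgebra.star_left_conjugate_le_norm_smul (a := p) (b := p - a) hsa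
  have h2 : ‖p - a‖ • (star p * p) ≤ (1 / 2 : ℝ) • p := by
    rw [hs, hi]
    exact smul_le_smul_of_nonneg_right hn hp0
  have h3 : star p * (p - a) * p = p - p * a * p := by
    rw [hs, mul_sub, sub_mul, hi, hi]
  have h4 : 0 ≤ p * a * p := by
    have := star_left_conjugate_nonneg ha p
    rwa [hs] at this
  have h5 : p ≤ ((2 : ℝ≥0) : ℝ) • (p * a * p) := by
    have h6 := h1.trans h2
    rw [h3, sub_le_iff_le_add] at h6
    have h7 : (1 / 2 : ℝ) • p ≤ p * a * p := by
      have : p = (1 / 2 : ℝ) • p + (1 / 2 : ℝ) • p := by rw [← add_smul]; norm_num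
      rw [← add_le_add_iff_left ((1 / 2 : ℝ) • p), ← this]
      exact h6
    have h8 := smul_le_smul_of_nonneg_left h7 (zero_le_two (α := ℝ))
    rw [smul_smul] at h8
    norm_num at h8
    exact h8
  refine (τ.apply_mono hp0 h5).trans_lt ?_
  rw [τ.apply_smul 2 h4]
  exact ENNReal.mul_lt_top ENNReal.coe_lt_top ((τ.apply_conj_le hp ha h4).trans_lt had)

/-- Values of the extended trace can thus be computed on pairs in the span of the graph, without
carrying proofs of domain membership. -/
theorem extend_of_mem_graphSpan (τ : CStarTrace A) {a : A} {c : ℂ} (h : (a, c) ∈ τ.graphSpan) :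
    ∃ h : a ∈ τ.extend.domain, τ.extend ⟨a, h⟩ = c := by
  have hmem : (a, c) ∈ τ.extend.graph := by
    rwa [extend, Submodule.toLinearPMap_graph_eq _ τ.snd_eq_zero_of_mem_graphSpan]
  obtain ⟨y, hy1, hy2⟩ := (LinearPMap.mem_graph_iff _).1 hmem
  have hy : (y : A) = a := hy1
  have hmem' : a ∈ τ.extend.domain := hy ▸ y.2
  have hya : y = ⟨a, hmem'⟩ := Subtype.ext hy
  exact ⟨hmem', hya ▸ hy2⟩

/-- By the parallelogram identity, `2(xx⋆ + yy⋆) - (x + y)(x + y)⋆ = (x - y)(x - y)⋆ ≥ 0`. -/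
theorem apply_add_mul_star_lt_top (τ : CStarTrace A) {x y : A}
    (hx : τ ⟨x * star x, mul_star_self_nonneg x⟩ < ∞)
    (hy : τ ⟨y * star y, mul_star_self_nonneg y⟩ < ∞) :
    τ ⟨(x + y) * star (x + y), mul_star_self_nonneg _⟩ < ∞ := by
  have h0 : 0 ≤ x * star x + y * star y :=
    add_nonneg (mul_star_self_nonneg x) (mul_star_self_nonneg y)
  have h1 : (x + y) * star (x + y) ≤ ((2 : ℝ≥0) : ℝ) • (x * star x + y * star y) := by
    rw [← sub_nonneg]
    have : ((2 : ℝ≥0) : ℝ) • (x * star x + y * star y) - (x + y) * star (x + y) =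
        (x - y) * star (x - y) := by
      simp only [NNReal.coe_ofNat, two_smul, star_add, star_sub, mul_add, add_mul, mul_sub, sub_mul]
      abel
    rw [this]
    exact mul_star_self_nonneg _
  refine (τ.apply_mono _ h1).trans_lt ?_
  rw [τ.apply_smul 2 h0, τ.apply_add (mul_star_self_nonneg x) (mul_star_self_nonneg y)]
  exact ENNReal.mul_lt_top ENNReal.coe_lt_top (ENNReal.add_lt_top.2 ⟨hx, hy⟩)

/-- The tracial property `τ (x y⋆) = τ (y⋆ x)` of the extended trace. -/
theorem extend_mul_star (τ : CStarTrace A) {x y : A}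
    (hx : τ ⟨x * star x, mul_star_self_nonneg x⟩ < ∞)
    (hy : τ ⟨y * star y, mul_star_self_nonneg y⟩ < ∞) :
    ∃ (h : x * star y ∈ τ.extend.domain) (h' : star y * x ∈ τ.extend.domain),
      τ.extend ⟨x * star y, h⟩ = τ.extend ⟨star y * x, h'⟩ := by
  -- Polarization over `c = ±1, ±i`: both `xy⋆` and `y⋆x` are `1/4 ∑ c` times the terms `(x + cy)(x
  -- + cy)⋆`, respectively `(x + cy)⋆(x + cy)`. The coefficients agree, and so do the traces `t` of
  -- corresponding terms.
  have key : ∀ c : ℂ, c * star c = 1 → ∃ t : ℂ,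
      ((x + c • y) * star (x + c • y), t) ∈ τ.graphSpan ∧
      (star (x + c • y) * (x + c • y), t) ∈ τ.graphSpan := fun c hc => by
    have hfin : τ ⟨(x + c • y) * star (x + c • y), mul_star_self_nonneg _⟩ < ∞ := by
      refine τ.apply_add_mul_star_lt_top hx ?_
      have : y * star y = (c • y) * star (c • y) := by
        rw [star_smul, smul_mul_smul_comm, hc, one_smul]
      rwa [τ.apply_congr _ this] at hy
    refine ⟨_, Submodule.subset_span ⟨⟨_, mul_star_self_nonneg _⟩, hfin, rfl⟩, ?_⟩
    rw [← τ.map_star_mul'] at hfin ⊢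
    exact Submodule.subset_span ⟨_, hfin, rfl⟩
  have hI : Complex.I * star Complex.I = 1 := by simp
  obtain ⟨t1, h1, g1⟩ := key 1 (by simp)
  obtain ⟨t2, h2, g2⟩ := key (-1) (by simp)
  obtain ⟨t3, h3, g3⟩ := key Complex.I (by simp)
  obtain ⟨t4, h4, g4⟩ := key (-Complex.I) (by simp)
  have comb : ∀ X1 X2 X3 X4 : A × ℂ, X1 ∈ τ.graphSpan → X2 ∈ τ.graphSpan → X3 ∈ τ.graphSpan →
      X4 ∈ τ.graphSpan → (4⁻¹ : ℂ) • (X1 - X2 + Complex.I • (X3 - X4)) ∈ τ.graphSpan :=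
    fun X1 X2 X3 X4 m1 m2 m3 m4 => Submodule.smul_mem _ _ (Submodule.add_mem _
      (Submodule.sub_mem _ m1 m2) (Submodule.smul_mem _ _ (Submodule.sub_mem _ m3 m4)))
  have e1 : (4⁻¹ : ℂ) • (((x + (1 : ℂ) • y) * star (x + (1 : ℂ) • y) -
      (x + (-1 : ℂ) • y) * star (x + (-1 : ℂ) • y)) +
      Complex.I • ((x + Complex.I • y) * star (x + Complex.I • y) -
      (x + (-Complex.I) • y) * star (x + (-Complex.I) • y))) = x * star y := by
    simp only [star_add, star_smul, star_one, star_neg, Complex.star_def, Complex.conj_I,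
      mul_add, add_mul, smul_mul_assoc, mul_smul_comm, smul_sub, smul_add, smul_smul, neg_mul,
      mul_neg, neg_neg, mul_one, Complex.I_mul_I]
    module
  have e2 : (4⁻¹ : ℂ) • ((star (x + (1 : ℂ) • y) * (x + (1 : ℂ) • y) -
      star (x + (-1 : ℂ) • y) * (x + (-1 : ℂ) • y)) +
      Complex.I • (star (x + Complex.I • y) * (x + Complex.I • y) -
      star (x + (-Complex.I) • y) * (x + (-Complex.I) • y))) = star y * x := by
    simp only [star_add, star_smul, star_one, star_neg, Complex.star_def, Complex.conj_I,
      mul_add, add_mul, smul_mul_assoc, mul_smul_comm, smul_sub, smul_add, smul_smul, neg_mul,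
      mul_neg, neg_neg, mul_one, Complex.I_mul_I]
    module
  have m1 := comb _ _ _ _ h1 h2 h3 h4
  have m2 := comb _ _ _ _ g1 g2 g3 g4
  obtain ⟨d1, k1⟩ := τ.extend_of_mem_graphSpan (a := x * star y)
    (c := (4⁻¹ : ℂ) • (t1 - t2 + Complex.I • (t3 - t4))) (by rw [← e1]; exact m1)
  obtain ⟨d2, k2⟩ := τ.extend_of_mem_graphSpan (a := star y * x)
    (c := (4⁻¹ : ℂ) • (t1 - t2 + Complex.I • (t3 - t4))) (by rw [← e2]; exact m2)
  exact ⟨d1, d2, k1.trans k2.symm⟩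

theorem apply_corner_le (τ : CStarTrace A) {p : A} (hp : IsStarProjection p) {a : A}
    (ha : 0 ≤ a) (hpa : 0 ≤ p * a * p) : τ ⟨p * a * p, hpa⟩ ≤ ‖a‖₊ * τ ⟨p, hp.nonneg⟩ := by
  have h1 := CStarAlgebra.star_left_conjugate_le_norm_smul (a := p) (b := a) (.of_nonneg ha)
  rw [hp.isSelfAdjoint.star_eq, hp.isIdempotentElem.eq] at h1
  exact (τ.apply_mono hpa h1).trans
    (τ.apply_smul ‖a‖₊ hp.nonneg (smul_nonneg (norm_nonneg a) hp.nonneg)).le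

/-- Positive elements span `A`, and for `a ≥ 0` the bound `pap ≤ ‖a‖p` makes the trace finite. -/
theorem mul_mem_domain_of_projection (τ : CStarTrace A) {p : A} (hp : IsStarProjection p)
    (hτ : τ ⟨p, hp.nonneg⟩ < ∞) (a : A) : p * a * p ∈ τ.extend.domain := by
  have hs : star p = p := hp.isSelfAdjoint.star_eq
  have ha : a ∈ Submodule.span ℂ {a : A | 0 ≤ a} := by
    rw [CStarAlgebra.span_nonneg]; trivial
  induction ha using Submodule.span_induction with
  | mem a ha =>
    have h0 : 0 ≤ p * a * p := by
      have := star_left_conjugate_nonneg ha p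
      rwa [hs] at this
    refine (τ.extend_coe ⟨p * a * p, h0⟩ ?_).1
    exact (τ.apply_corner_le hp ha h0).trans_lt (ENNReal.mul_lt_top ENNReal.coe_lt_top hτ)
  | zero => simp
  | add a b _ _ ha hb => simpa only [mul_add, add_mul] using add_mem ha hb
  | smul c a _ ha => simpa only [mul_smul_comm, smul_mul_assoc] using Submodule.smul_mem _ c ha

open scoped ComplexOrder in
/-- The positive functional `a ↦ τ (p a p)` for a projection `p` of finite trace. -/
theorem exists_corner_functional (τ : CStarTrace A) {p : A} (hp : IsStarProjection p)
    (hτ : τ ⟨p, hp.nonneg⟩ < ∞) :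
    ∃ φ : A →L[ℂ] ℂ, ∀ a : A, 0 ≤ a → ∀ h : 0 ≤ p * a * p,
      φ a = ((τ ⟨p * a * p, h⟩).toReal : ℂ) := by
  let c : A →ₗ[ℂ] A := LinearMap.mulLeft ℂ p ∘ₗ LinearMap.mulRight ℂ p
  have hc : ∀ a, c a = p * a * p := fun a => by simp [c, mul_assoc]
  let f : A →ₗ[ℂ] ℂ := τ.extend.toFun ∘ₗ
    c.codRestrict τ.extend.domain fun a => by
      rw [hc]; exact τ.mul_mem_domain_of_projection hp hτ a
  have hf : ∀ a : A, 0 ≤ a → ∀ h : 0 ≤ p * a * p, f a = ((τ ⟨p * a * p, h⟩).toReal : ℂ) := by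
    intro a ha h
    obtain ⟨h1, h2⟩ := τ.extend_coe ⟨p * a * p, h⟩
      ((τ.apply_corner_le hp ha h).trans_lt (ENNReal.mul_lt_top ENNReal.coe_lt_top hτ))
    rw [← h2]
    change τ.extend _ = _
    congr 1
    exact Subtype.ext (hc a)
  let g : A →ₚ[ℂ] ℂ := PositiveLinearMap.mk₀ f fun a ha => by
    have h : 0 ≤ p * a * p := by
      have := star_left_conjugate_nonneg ha p
      rwa [hp.isSelfAdjoint.star_eq] at this
    rw [hf a ha h]
    exact_mod_cast ENNReal.toReal_nonneg
  -- Positive functionals on a C⋆-algebra are automatically continuous.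
  exact ⟨⟨f, map_continuous g⟩, hf⟩

end CStarTrace

/-! ### Combinatorics of initial segments and boundary paths. -/

namespace KGraph

variable {k : ℕ} {V : Type u} [Category.{v} V] (Λ : KGraph k V)

/-- `p` is an initial segment of `q`. -/
def IsPrefix {x : V} (p q : Λ.PathsTo x) : Prop := ∃ g : q.1 ⟶ p.1, g ≫ p.2 = q.2

/-- The path `f p` for a path `f` and a path `p` with range `s(f)`. -/
def cons {a b : V} (f : a ⟶ b) (p : Λ.PathsTo a) : Λ.PathsTo b := ⟨p.1, p.2 ≫ f⟩

variable {Λ}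

theorem cons_id {a : V} (p : Λ.PathsTo a) : Λ.cons (𝟙 a) p = p := by
  simp [cons]

theorem cons_comp {a b c : V} (ν : a ⟶ b) (μ : b ⟶ c) (p : Λ.PathsTo a) :
    Λ.cons (ν ≫ μ) p = Λ.cons μ (Λ.cons ν p) := by
  simp [cons]

theorem deg_cons {a b : V} (f : a ⟶ b) (p : Λ.PathsTo a) :
    Λ.deg (Λ.cons f p).2 = Λ.deg f + Λ.deg p.2 := Λ.deg_comp _ _

theorem isPrefix_iff {x : V} {p q : Λ.PathsTo x} :
    Λ.IsPrefix p q ↔ ∃ g : Λ.PathsTo p.1, q = Λ.cons p.2 g := by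
  constructor
  · rintro ⟨g, hg⟩
    exact ⟨⟨q.1, g⟩, Sigma.ext rfl (heq_of_eq hg.symm)⟩
  · rintro ⟨g, rfl⟩
    exact ⟨g.2, rfl⟩

theorem IsPrefix.refl {x : V} (p : Λ.PathsTo x) : Λ.IsPrefix p p := ⟨𝟙 _, Category.id_comp _⟩

theorem IsPrefix.trans {x : V} {p q r : Λ.PathsTo x} (h : Λ.IsPrefix p q) (h' : Λ.IsPrefix q r) :
    Λ.IsPrefix p r := by
  obtain ⟨g, hg⟩ := h
  obtain ⟨g', hg'⟩ := h'
  exact ⟨g' ≫ g, by rw [Category.assoc, hg, hg']⟩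

theorem IsPrefix.deg_le {x : V} {p q : Λ.PathsTo x} (h : Λ.IsPrefix p q) :
    Λ.deg p.2 ≤ Λ.deg q.2 := by
  obtain ⟨g, hg⟩ := h
  rw [← hg, Λ.deg_comp]
  exact le_self_add

theorem IsPrefix.cons {a b : V} (f : a ⟶ b) {p q : Λ.PathsTo a} (h : Λ.IsPrefix p q) :
    Λ.IsPrefix (Λ.cons f p) (Λ.cons f q) := by
  obtain ⟨g, hg⟩ := h
  exact ⟨g, by simp [KGraph.cons, ← hg]⟩

theorem isPrefix_cons {a b : V} (f : a ⟶ b) (p : Λ.PathsTo a) :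
    Λ.IsPrefix ⟨a, f⟩ (Λ.cons f p) := ⟨p.2, rfl⟩

theorem id_isPrefix {x : V} (p : Λ.PathsTo x) : Λ.IsPrefix ⟨x, 𝟙 x⟩ p :=
  ⟨p.2, Category.comp_id _⟩

theorem exists_isPrefix {x : V} (q : Λ.PathsTo x) {m : Fin k → ℕ} (hm : m ≤ Λ.deg q.2) :
    ∃ p : Λ.PathsTo x, Λ.IsPrefix p q ∧ Λ.deg p.2 = m := by
  obtain ⟨⟨c, g, p⟩, ⟨h1, -, h3⟩, -⟩ := Λ.factorisation q.2 m (Λ.deg q.2 - m)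
    (add_tsub_cancel_of_le hm).symm
  exact ⟨⟨c, p⟩, ⟨g, h3⟩, h1⟩

theorem factorisation_unique {a b c c' : V} {g : a ⟶ c} {p : c ⟶ b} {g' : a ⟶ c'} {p' : c' ⟶ b}
    (h : g ≫ p = g' ≫ p') (hd : Λ.deg p = Λ.deg p') :
    (⟨c, g, p⟩ : Σ c : V, (a ⟶ c) × (c ⟶ b)) = ⟨c', g', p'⟩ := by
  have hg : Λ.deg g' = Λ.deg g := by
    have := congrArg Λ.deg h
    rw [Λ.deg_comp, Λ.deg_comp, hd] at this
    exact (add_left_cancel this).symm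
  exact (Λ.factorisation (g ≫ p) _ _ (Λ.deg_comp g p)).unique ⟨rfl, rfl, rfl⟩
    ⟨hd.symm, hg, h.symm⟩

theorem cons_injective {a b : V} (f : a ⟶ b) : Function.Injective (Λ.cons f) := by
  rintro ⟨c, p⟩ ⟨c', q⟩ h
  obtain rfl : c = c' := congrArg Sigma.fst h
  have h' : p ≫ f = q ≫ f := eq_of_heq (Sigma.mk.inj h).2
  have := factorisation_unique (Λ := Λ) h' rfl
  rw [(Prod.mk.inj (eq_of_heq (Sigma.mk.inj this).2)).1]

theorem isPrefix_cons_iff {a b : V} (f : a ⟶ b) {p q : Λ.PathsTo a} :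
    Λ.IsPrefix (Λ.cons f p) (Λ.cons f q) ↔ Λ.IsPrefix p q := by
  refine ⟨fun h => ?_, IsPrefix.cons f⟩
  obtain ⟨g, hg⟩ := isPrefix_iff.1 h
  refine isPrefix_iff.2 ⟨g, cons_injective f ?_⟩
  rw [hg]
  exact cons_comp p.2 f g

theorem IsPrefix.eq_of_deg_eq {x : V} {p p' q : Λ.PathsTo x} (h : Λ.IsPrefix p q)
    (h' : Λ.IsPrefix p' q) (hd : Λ.deg p.2 = Λ.deg p'.2) : p = p' := by
  obtain ⟨g, hg⟩ := h
  obtain ⟨g', hg'⟩ := h'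
  have := factorisation_unique (Λ := Λ) (hg.trans hg'.symm) hd
  exact congrArg (fun t => (⟨t.1, t.2.2⟩ : Λ.PathsTo x)) this

theorem IsPrefix.of_deg_le {x : V} {p p' q : Λ.PathsTo x} (h : Λ.IsPrefix p q)
    (h' : Λ.IsPrefix p' q) (hd : Λ.deg p.2 ≤ Λ.deg p'.2) : Λ.IsPrefix p p' := by
  obtain ⟨r, hr, hrd⟩ := exists_isPrefix p' hd
  rwa [h.eq_of_deg_eq (hr.trans h') hrd.symm]

/-- The segment of `q` whose degree is the join works, because segments of one path are ordered by
their degrees. -/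
theorem IsPrefix.exists_sup {x : V} {p p' q : Λ.PathsTo x} (h : Λ.IsPrefix p q)
    (h' : Λ.IsPrefix p' q) : ∃ r : Λ.PathsTo x, Λ.IsPrefix p r ∧ Λ.IsPrefix p' r ∧
      Λ.deg r.2 = Λ.deg p.2 ⊔ Λ.deg p'.2 := by
  obtain ⟨r, hr, hrd⟩ := exists_isPrefix q (sup_le h.deg_le h'.deg_le)
  exact ⟨r, h.of_deg_le hr (hrd ▸ le_sup_left), h'.of_deg_le hr (hrd ▸ le_sup_right), hrd⟩

theorem eq_id_of_deg_eq_zero {x : V} {p : Λ.PathsTo x} (h : Λ.deg p.2 = 0) : p = ⟨x, 𝟙 x⟩ :=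
  ((id_isPrefix p).eq_of_deg_eq (IsPrefix.refl p) (by rw [h, Λ.deg_id])).symm

/-- This recasts `vΛ^{≤ n}` as the prefix-maximal paths among those of degree at most `n`, the form
used throughout. -/
theorem mem_pathsLE_iff {x : V} {n : Fin k → ℕ} {p : Λ.PathsTo x} :
    p ∈ Λ.pathsLE x n ↔ Λ.deg p.2 ≤ n ∧
      ∀ q : Λ.PathsTo x, Λ.IsPrefix p q → Λ.deg q.2 ≤ n → q = p := by
  refine and_congr_right fun _ => ⟨fun h q hq hn => ?_, fun h q hq => ?_⟩
  · obtain ⟨g, rfl⟩ := isPrefix_iff.1 hq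
    rw [h g hn]
    simp [cons]
  · have h1 := h (Λ.cons p.2 q) (isPrefix_cons p.2 q) hq
    have h2 := deg_cons p.2 q
    rw [h1] at h2
    exact eq_id_of_deg_eq_zero (left_eq_add.1 h2)

theorem mem_pathsLE_deg {x : V} (p : Λ.PathsTo x) : p ∈ Λ.pathsLE x (Λ.deg p.2) :=
  mem_pathsLE_iff.2 ⟨le_rfl, fun q hq hn =>
    ((hq.eq_of_deg_eq (IsPrefix.refl q)) (le_antisymm hq.deg_le hn)).symm⟩

/-- The least common extension of `p` and `p'` inside `q` still has degree at most `n`, so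
maximality of `p` forces it to equal `p`. -/
theorem isPrefix_of_mem_pathsLE {x : V} {n : Fin k → ℕ} {p p' q : Λ.PathsTo x}
    (hp : p ∈ Λ.pathsLE x n) (hn : Λ.deg p'.2 ≤ n) (h : Λ.IsPrefix p q) (h' : Λ.IsPrefix p' q) :
    Λ.IsPrefix p' p := by
  obtain ⟨r, h1, h2, h3⟩ := h.exists_sup h'
  rwa [(mem_pathsLE_iff.1 hp).2 r h1 (h3 ▸ sup_le hp.1 hn)] at h2

theorem eq_of_mem_pathsLE {x : V} {n : Fin k → ℕ} {p p' q : Λ.PathsTo x}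
    (hp : p ∈ Λ.pathsLE x n) (hp' : p' ∈ Λ.pathsLE x n) (h : Λ.IsPrefix p q)
    (h' : Λ.IsPrefix p' q) : p = p' :=
  (mem_pathsLE_iff.1 hp').2 p (isPrefix_of_mem_pathsLE hp hp'.1 h h') hp.1

/-- Only finitely many degrees lie below `n`; a path of maximal degree among them cannot be
prolonged. -/
theorem pathsLE_nonempty (x : V) (n : Fin k → ℕ) : (Λ.pathsLE x n).Nonempty := by
  have hfin : (Set.Iic n ∩ {m | ∃ p : Λ.PathsTo x, Λ.deg p.2 = m}).Finite :=
    (Set.finite_Iic n).inter_of_left _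
  obtain ⟨m, ⟨⟨hmn, p, rfl⟩, hmax⟩⟩ := hfin.exists_maximal
    ⟨0, fun _ => Nat.zero_le _, ⟨x, 𝟙 x⟩, Λ.deg_id x⟩
  refine ⟨p, mem_pathsLE_iff.2 ⟨hmn, fun q hq hqn => ?_⟩⟩
  exact ((hq.eq_of_deg_eq (IsPrefix.refl q))
    (le_antisymm hq.deg_le (hmax ⟨hqn, q, rfl⟩ hq.deg_le))).symm

/-- In a locally convex graph, a vertex that receives an edge of degree `e_i` only receives paths
with `i`-th degree zero from vertices that also receive such an edge. -/
theorem LocallyConvex.exists_edge (hΛ : Λ.LocallyConvex) {i : Fin k} :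
    ∀ (N : ℕ) {x : V} (p : Λ.PathsTo x), ∑ j, Λ.deg p.2 j = N → Λ.deg p.2 i = 0 →
      (∃ q : Λ.PathsTo x, Λ.deg q.2 = basisVec i) →
        ∃ q : Λ.PathsTo p.1, Λ.deg q.2 = basisVec i := by
  intro N
  induction N with
  | zero =>
    intro x p hp _ hx
    have : Λ.deg p.2 = 0 := funext fun j => by
      simpa using (Finset.sum_eq_zero_iff.1 hp) j (Finset.mem_univ j)
    rw [eq_id_of_deg_eq_zero this]
    exact hx
  | succ N ih =>
    intro x p hp hi hx
    obtain ⟨j, hj⟩ : ∃ j, Λ.deg p.2 j ≠ 0 := by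
      by_contra! h
      simp [h] at hp
    have hji : i ≠ j := by rintro rfl; exact hj hi
    have hjle : basisVec j ≤ Λ.deg p.2 := by
      intro l
      by_cases hl : l = j
      · subst hl; simpa [basisVec] using Nat.one_le_iff_ne_zero.2 hj
      · simp [basisVec, hl]
    -- Peel off an initial edge `e` of degree `e_j`, `j ≠ i`. The contrapositive of local convexity
    -- moves the edge of degree `e_i` from `r(e)` to `s(e)`, and the induction continues with the
    -- shorter remainder.
    obtain ⟨e, he, hed⟩ := exists_isPrefix p hjle
    obtain ⟨g, rfl⟩ := isPrefix_iff.1 he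
    have hd := deg_cons e.2 g
    have hsum : ∑ l, Λ.deg g.2 l = N := by
      rw [hd, hed] at hp
      simp only [Pi.add_apply, Finset.sum_add_distrib, basisVec, Finset.sum_pi_single',
        Finset.mem_univ, if_true] at hp
      omega
    refine ih g hsum ?_ ?_
    · rw [hd, Pi.add_apply] at hi
      omega
    · by_contra h
      have := hΛ e.2 j i hed hji (Set.eq_empty_iff_forall_notMem.2 fun q hq => h ⟨q, hq⟩)
      obtain ⟨q, hq⟩ := hx
      exact (Set.eq_empty_iff_forall_notMem.1 this) q hq

/-- In a locally convex graph the elements of `vΛ^{≤ n}` have initial segments in `vΛ^{≤ m}`,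
`m ≤ n`. -/
theorem LocallyConvex.exists_isPrefix_mem_pathsLE (hΛ : Λ.LocallyConvex) {x : V}
    {m n : Fin k → ℕ} (hmn : m ≤ n) {q : Λ.PathsTo x} (hq : q ∈ Λ.pathsLE x n) :
    ∃ p ∈ Λ.pathsLE x m, Λ.IsPrefix p q := by
  obtain ⟨p, hpq, hpd⟩ := exists_isPrefix q (m := m ⊓ Λ.deg q.2) inf_le_right
  refine ⟨p, mem_pathsLE_iff.2 ⟨hpd ▸ inf_le_left, fun r hr hrm => ?_⟩, hpq⟩
  -- If `r` properly extends `p` within `m`, it grows in some coordinate `i`, where `d(p)_i < m_i`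
  -- and so `d(p)_i = d(q)_i`. The rest `h` of `q` then has `i`-th degree zero, and local convexity
  -- provides an edge `e'` of degree `e_i` at `s(q)`. As `d(q)_i < m_i ≤ n_i`, the path `qe'` still
  -- has degree at most `n`, against maximality of `q`.
  by_contra hne
  obtain ⟨i, hi⟩ : ∃ i, Λ.deg p.2 i < Λ.deg r.2 i := by
    by_contra! h
    exact hne ((hr.eq_of_deg_eq (IsPrefix.refl r)) (le_antisymm hr.deg_le h)).symm
  have hpi : Λ.deg p.2 i = min (m i) (Λ.deg q.2 i) := congrFun hpd i
  have hri : Λ.deg r.2 i ≤ m i := hrm i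
  have hmi : m i ≤ n i := hmn i
  have hqi : Λ.deg p.2 i = Λ.deg q.2 i := by
    rcases min_choice (m i) (Λ.deg q.2 i) with h | h <;> rw [h] at hpi
    · omega
    · exact hpi
  obtain ⟨g, hgr⟩ := isPrefix_iff.1 hr
  obtain ⟨h, hhq⟩ := isPrefix_iff.1 hpq
  have hdg : Λ.deg r.2 = Λ.deg p.2 + Λ.deg g.2 := by rw [hgr]; exact deg_cons p.2 g
  have hdh : Λ.deg q.2 = Λ.deg p.2 + Λ.deg h.2 := by rw [hhq]; exact deg_cons p.2 h
  have hdgi : Λ.deg r.2 i = Λ.deg p.2 i + Λ.deg g.2 i := congrFun hdg i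
  have hdhi : Λ.deg q.2 i = Λ.deg p.2 i + Λ.deg h.2 i := congrFun hdh i
  have hle : basisVec i ≤ Λ.deg g.2 := by
    intro l
    by_cases hl : l = i
    · subst hl
      simp only [basisVec, Pi.single_eq_same]
      omega
    · simp [basisVec, hl]
  obtain ⟨e, -, he⟩ := exists_isPrefix g hle
  obtain ⟨e', he'⟩ := hΛ.exists_edge _ h rfl (by omega) ⟨e, he⟩
  have hde : Λ.deg (Λ.cons p.2 (Λ.cons h.2 e')).2 = Λ.deg q.2 + basisVec i := by
    rw [deg_cons, deg_cons, he', hdh, add_assoc]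
  have h1 := (mem_pathsLE_iff.1 hq).2 (Λ.cons p.2 (Λ.cons h.2 e'))
    (by rw [hhq]; exact (isPrefix_cons h.2 e').cons p.2) ?_
  · rw [h1] at hde
    simpa [basisVec] using congrFun (left_eq_add.1 hde) i
  · rw [hde]
    intro l
    have : Λ.deg q.2 l ≤ n l := hq.1 l
    by_cases hl : l = i
    · subst hl
      simp only [Pi.add_apply, basisVec, Pi.single_eq_same]
      omega
    · simpa [basisVec, hl] using this

variable (Λ) in
/-- A boundary path with range `x`, described by the set of its finite initial segments. -/
structure IsBoundary {x : V} (U : Set (Λ.PathsTo x)) : Prop where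
  down : ∀ {p q}, Λ.IsPrefix p q → q ∈ U → p ∈ U
  directed : ∀ {p q}, p ∈ U → q ∈ U → ∃ r ∈ U, Λ.IsPrefix p r ∧ Λ.IsPrefix q r
  meets : ∀ n, ∃ p ∈ U, p ∈ Λ.pathsLE x n

/-- A compactness argument: choose `y N ∈ xΛ^{≤ N}` and keep the paths that are prefixes of `y N`
for almost all `N` along an ultrafilter. Since `xΛ^{≤ n}` is finite, the ultrafilter selects one of
its elements for each `n`. -/
theorem LocallyConvex.exists_isBoundary (hΛ : Λ.LocallyConvex) (hrow : Λ.RowFinite) (x : V) :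
    ∃ U : Set (Λ.PathsTo x), Λ.IsBoundary U := by
  choose y hy using fun n => Λ.pathsLE_nonempty x n
  let F : Ultrafilter (Fin k → ℕ) := Ultrafilter.of atTop
  have hF : ∀ n, ∀ᶠ N in (F : Filter (Fin k → ℕ)), n ≤ N := fun n =>
    (Ultrafilter.of_le atTop) (eventually_ge_atTop n)
  have meets : ∀ n, ∃ p ∈ Λ.pathsLE x n, ∀ᶠ N in (F : Filter _), Λ.IsPrefix p (y N) := fun n => by
    refine (Ultrafilter.eventually_exists_mem_iff (Λ.pathsLE_finite hrow x n)).1 ?_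
    exact (hF n).mono fun N hN => hΛ.exists_isPrefix_mem_pathsLE hN (hy N)
  refine ⟨{p | ∀ᶠ N in (F : Filter _), Λ.IsPrefix p (y N)},
    fun {p q} h hq => ?_, fun {p q} hp hq => ?_, fun n => ?_⟩
  · rw [Set.mem_ofPred_eq] at hq ⊢
    exact hq.mono fun N => h.trans
  · obtain ⟨r, hr, hrF⟩ := meets (Λ.deg p.2 ⊔ Λ.deg q.2)
    obtain ⟨N, hN⟩ := (hp.and (hq.and hrF)).exists
    exact ⟨r, hrF, isPrefix_of_mem_pathsLE hr le_sup_left hN.2.2 hN.1,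
      isPrefix_of_mem_pathsLE hr le_sup_right hN.2.2 hN.2.1⟩
  · obtain ⟨p, hp, hpF⟩ := meets n
    exact ⟨p, hpF, hp⟩

variable (Λ) in
/-- The boundary path `f U`. -/
def extendBy {a b : V} (f : a ⟶ b) (U : Set (Λ.PathsTo a)) : Set (Λ.PathsTo b) :=
  {q | ∃ p ∈ U, Λ.IsPrefix q (Λ.cons f p)}

theorem cons_mem_extendBy {a b : V} (f : a ⟶ b) {U : Set (Λ.PathsTo a)} (hU : Λ.IsBoundary U)
    {p : Λ.PathsTo a} : Λ.cons f p ∈ Λ.extendBy f U ↔ p ∈ U :=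
  ⟨fun ⟨_, hq, h⟩ => hU.down ((isPrefix_cons_iff f).1 h) hq, fun h => ⟨p, h, IsPrefix.refl _⟩⟩

theorem extendBy_injective {a b : V} (f : a ⟶ b) {U U' : Set (Λ.PathsTo a)}
    (hU : Λ.IsBoundary U) (hU' : Λ.IsBoundary U') (h : Λ.extendBy f U = Λ.extendBy f U') :
    U = U' := by
  ext p
  rw [← cons_mem_extendBy f hU, h, cons_mem_extendBy f hU']

theorem extendBy_id {a : V} {U : Set (Λ.PathsTo a)} (hU : Λ.IsBoundary U) :
    Λ.extendBy (𝟙 a) U = U := by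
  ext p
  rw [← cons_mem_extendBy (𝟙 a) hU, cons_id]

theorem extendBy_comp {a b c : V} (ν : a ⟶ b) (μ : b ⟶ c) (U : Set (Λ.PathsTo a)) :
    Λ.extendBy (ν ≫ μ) U = Λ.extendBy μ (Λ.extendBy ν U) := by
  ext q
  constructor
  · rintro ⟨p, hp, h⟩
    exact ⟨Λ.cons ν p, ⟨p, hp, IsPrefix.refl _⟩, by rwa [← cons_comp]⟩
  · rintro ⟨r, ⟨p, hp, h⟩, h'⟩
    exact ⟨p, hp, by rw [cons_comp]; exact h'.trans (h.cons μ)⟩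

theorem mem_extendBy_self {a b : V} (f : a ⟶ b) {U : Set (Λ.PathsTo a)} (hU : Λ.IsBoundary U) :
    (⟨a, f⟩ : Λ.PathsTo b) ∈ Λ.extendBy f U := by
  obtain ⟨p, hp, -⟩ := hU.meets 0
  exact ⟨p, hp, isPrefix_cons f p⟩

/-- Every extension of `fp` again begins with `f`, so maximality transfers both ways. -/
theorem cons_mem_pathsLE {a b : V} (f : a ⟶ b) {p : Λ.PathsTo a} {n : Fin k → ℕ} :
    Λ.cons f p ∈ Λ.pathsLE b (Λ.deg f + n) ↔ p ∈ Λ.pathsLE a n := by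
  rw [mem_pathsLE_iff, mem_pathsLE_iff, deg_cons, add_le_add_iff_left]
  refine and_congr_right fun _ => ⟨fun h q hq hn => ?_, fun h q hq hn => ?_⟩
  · exact cons_injective f (h _ (hq.cons f) (by rw [deg_cons]; gcongr))
  · obtain ⟨g, rfl⟩ := isPrefix_iff.1 hq
    have e : Λ.cons (Λ.cons f p).2 g = Λ.cons f (Λ.cons p.2 g) := cons_comp p.2 f g
    rw [e, deg_cons, add_le_add_iff_left] at hn
    rw [e, h _ (isPrefix_cons p.2 g) hn]

theorem IsBoundary.extendBy (hΛ : Λ.LocallyConvex) {a b : V} (f : a ⟶ b) {U : Set (Λ.PathsTo a)}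
    (hU : Λ.IsBoundary U) : Λ.IsBoundary (Λ.extendBy f U) where
  down := fun h ⟨r, hr, h'⟩ => ⟨r, hr, h.trans h'⟩
  directed := by
    rintro p q ⟨p', hp', hp⟩ ⟨q', hq', hq⟩
    obtain ⟨r, hr, h1, h2⟩ := hU.directed hp' hq'
    exact ⟨_, ⟨r, hr, IsPrefix.refl _⟩, hp.trans (h1.cons f), hq.trans (h2.cons f)⟩
  meets n := by
    obtain ⟨p, hp, hpn⟩ := hU.meets n
    -- The path `fp` is maximal only for the bound `d(f) + n`; local convexity cuts it down to a
    -- segment maximal for `n`.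
    obtain ⟨q, hq, hqp⟩ := hΛ.exists_isPrefix_mem_pathsLE (le_add_self : n ≤ Λ.deg f + n)
      ((cons_mem_pathsLE f).2 hpn)
    exact ⟨q, ⟨p, hp, hqp⟩, hq⟩

/-- The tail after `p` consists of all `q` with `pq ∈ W`. Directedness lets any member of `W` be
prolonged inside `W` to a path that begins with `p`. -/
theorem IsBoundary.exists_eq_extendBy {b : V} {W : Set (Λ.PathsTo b)}
    (hW : Λ.IsBoundary W) {p : Λ.PathsTo b} (hp : p ∈ W) :
    ∃ U : Set (Λ.PathsTo p.1), Λ.IsBoundary U ∧ Λ.extendBy p.2 U = W := by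
  refine ⟨{q | Λ.cons p.2 q ∈ W}, ⟨fun h hq => hW.down (h.cons p.2) hq, fun {q r} hq hr => ?_,
    fun n => ?_⟩, ?_⟩
  · obtain ⟨t, ht, h1, h2⟩ := hW.directed hq hr
    obtain ⟨g, rfl⟩ := isPrefix_iff.1 ((isPrefix_cons p.2 q).trans h1)
    exact ⟨g, ht, (isPrefix_cons_iff p.2).1 h1, (isPrefix_cons_iff p.2).1 h2⟩
  · obtain ⟨r, hr, hrn⟩ := hW.meets (Λ.deg p.2 + n)
    obtain ⟨t, ht, h1, h2⟩ := hW.directed hp hr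
    obtain ⟨g, rfl⟩ := isPrefix_iff.1 (isPrefix_of_mem_pathsLE hrn le_self_add h2 h1)
    exact ⟨g, hr, (cons_mem_pathsLE p.2).1 hrn⟩
  · ext q
    constructor
    · rintro ⟨r, hr, h⟩
      exact hW.down h hr
    · intro hq
      obtain ⟨t, ht, h1, h2⟩ := hW.directed hp hq
      obtain ⟨g, rfl⟩ := isPrefix_iff.1 h1
      exact ⟨g, ht, h2⟩

end KGraph

/-! ### Partial bijections acting on `ℓ²` as partial isometries. -/

namespace PEquiv

variable {α : Type u} {β : Type v}

open Classical in
/-- The partial equivalence given by a bi-unique relation. -/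
def ofRel (R : α → β → Prop) (h1 : ∀ a b b', R a b → R a b' → b = b')
    (h2 : ∀ a a' b, R a b → R a' b → a = a') : α ≃. β where
  toFun a := if h : ∃ b, R a b then some h.choose else none
  invFun b := if h : ∃ a, R a b then some h.choose else none
  inv a b := by
    constructor
    · intro h
      split_ifs at h with hb
      have hR := hb.choose_spec
      rw [Option.mem_some_iff.1 h] at hR
      have ha : ∃ b, R a b := ⟨b, hR⟩
      rw [dif_pos ha, h1 _ _ _ ha.choose_spec hR]
    · intro h
      split_ifs at h with ha
      have hR := ha.choose_spec
      rw [Option.mem_some_iff.1 h] at hR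
      have hb : ∃ a, R a b := ⟨a, hR⟩
      rw [dif_pos hb, h2 _ _ _ hb.choose_spec hR]

open Classical in
theorem mem_ofRel {R : α → β → Prop} {h1 : ∀ a b b', R a b → R a b' → b = b'}
    {h2 : ∀ a a' b, R a b → R a' b → a = a'} {a : α} {b : β} :
    b ∈ ofRel R h1 h2 a ↔ R a b := by
  change b ∈ (if h : ∃ b, R a b then some h.choose else none) ↔ _
  split_ifs with h
  · rw [Option.mem_some_iff]
    exact ⟨fun hb => hb ▸ h.choose_spec, h1 _ _ _ h.choose_spec⟩
  · exact ⟨fun hb => by simp at hb, fun hb => (h ⟨b, hb⟩).elim⟩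

variable (Y : Type u)

/-- The Hilbert space `ℓ²(Y)`. -/
local notation "ℓ²" => lp (fun _ : Y => ℂ) 2

variable {Y}

/-- The function `y ↦ g (φ⁻¹ y)`, extended by zero. -/
def push (φ : Y ≃. Y) (g : Y → ℂ) (y : Y) : ℂ := (φ.symm y).elim 0 g

theorem push_of_mem {φ : Y ≃. Y} {x y : Y} (h : y ∈ φ x) (g : Y → ℂ) : φ.push g y = g x := by
  rw [push, show φ.symm y = some x from φ.eq_some_iff.2 h]
  rfl

theorem push_of_forall_notMem {φ : Y ≃. Y} {y : Y} (h : ∀ x, y ∉ φ x) (g : Y → ℂ) :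
    φ.push g y = 0 := by
  rw [push]
  cases hy : φ.symm y with
  | none => rfl
  | some x => exact (h x (φ.eq_some_iff.1 hy)).elim

theorem push_trans (φ ψ : Y ≃. Y) (g : Y → ℂ) : (φ.trans ψ).push g = ψ.push (φ.push g) := by
  funext y
  by_cases h : ∃ x, y ∈ ψ x
  · obtain ⟨x, hx⟩ := h
    rw [push_of_mem hx]
    by_cases h' : ∃ z, x ∈ φ z
    · obtain ⟨z, hz⟩ := h'
      rw [push_of_mem hz, push_of_mem ((mem_trans φ ψ z y).2 ⟨x, hz, hx⟩)]
    · push Not at h'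
      rw [push_of_forall_notMem h', push_of_forall_notMem]
      intro z hz
      obtain ⟨x', hx', hy⟩ := (mem_trans φ ψ z y).1 hz
      exact h' z (ψ.inj hx hy ▸ hx')
  · push Not at h
    rw [push_of_forall_notMem h, push_of_forall_notMem]
    intro z hz
    obtain ⟨x', -, hy⟩ := (mem_trans φ ψ z y).1 hz
    exact h x' hy

/-- A partial bijection is injective, so each `‖g x‖²` occurs at most once on the left. -/
theorem sum_norm_push_le (φ : Y ≃. Y) (g : ℓ²) (s : Finset Y) :
    ∑ y ∈ s, ‖φ.push g y‖ ^ (2 : ℝ≥0∞).toReal ≤ ‖g‖ ^ (2 : ℝ≥0∞).toReal := by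
  classical
  have h2 : (0 : ℝ) < (2 : ℝ≥0∞).toReal := by norm_num
  refine le_trans ?_ (lp.sum_rpow_le_norm_rpow h2 g (s.biUnion fun y => (φ.symm y).toFinset))
  rw [Finset.sum_biUnion]
  · refine Finset.sum_le_sum fun y _ => ?_
    rw [push]
    cases φ.symm y with
    | none => simp
    | some x => simp
  · intro y _ y' _ hne
    refine Finset.disjoint_left.2 fun x hx hx' => hne ?_
    rw [Option.mem_toFinset] at hx hx'
    exact Option.mem_unique (φ.mem_iff_mem.1 hx) (φ.mem_iff_mem.1 hx')

/-- The partial isometry of `ℓ²(Y)` that maps the basis vector of `x` to that of `φ x`. -/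
def toCLM (φ : Y ≃. Y) : ℓ² →L[ℂ] ℓ² :=
  LinearMap.mkContinuous
    { toFun := fun g => ⟨φ.push g, memℓp_gen' (φ.sum_norm_push_le g)⟩
      map_add' := fun g h => lp.ext (funext fun y => by
        change (φ.symm y).elim 0 (g + h : ℓ²) = (φ.symm y).elim 0 g + (φ.symm y).elim 0 h
        cases φ.symm y with
        | none => exact (add_zero (0 : ℂ)).symm
        | some x => rfl)
      map_smul' := fun c g => lp.ext (funext fun y => by
        change (φ.symm y).elim 0 (c • g : ℓ²) = c * (φ.symm y).elim 0 g
        cases φ.symm y with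
        | none => exact (mul_zero c).symm
        | some x => rfl) } 1 fun g => by
    rw [one_mul]
    exact lp.norm_le_of_forall_sum_le (by norm_num) (norm_nonneg g) (φ.sum_norm_push_le g)

theorem toCLM_apply (φ : Y ≃. Y) (g : ℓ²) (y : Y) : φ.toCLM g y = φ.push g y := rfl

theorem toCLM_trans (φ ψ : Y ≃. Y) : (φ.trans ψ).toCLM = ψ.toCLM * φ.toCLM :=
  ContinuousLinearMap.ext fun g => lp.ext (push_trans φ ψ g)

/-- Both inner products are sums over the graph of `φ`, indexed by the first point on one side and
by the second on the other. -/
theorem star_toCLM (φ : Y ≃. Y) : star φ.toCLM = φ.symm.toCLM := by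
  symm
  rw [ContinuousLinearMap.star_eq_adjoint, ContinuousLinearMap.eq_adjoint_iff]
  intro g h
  rw [lp.inner_eq_tsum, lp.inner_eq_tsum]
  have e1 : ∀ x, inner ℂ (φ.symm.toCLM g x) (h x) =
      (φ x).elim 0 fun y => inner ℂ (g y) (h x) := fun x => by
    rw [toCLM_apply, push, symm_symm]
    cases φ x <;> simp
  have e2 : ∀ y, inner ℂ (g y) (φ.toCLM h y) =
      (φ.symm y).elim 0 fun x => inner ℂ (g y) (h x) := fun y => by
    rw [toCLM_apply, push]
    cases φ.symm y <;> simp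
  simp only [e1, e2]
  have hex : ∀ y : Function.support fun y => (φ.symm y).elim 0 fun x => inner ℂ (g y) (h x),
      ∃ x, φ.symm y = some x := fun y =>
    Option.ne_none_iff_exists'.1 fun h0 => Function.mem_support.1 y.2 (by rw [h0]; rfl)
  choose i hi using hex
  refine tsum_eq_tsum_of_ne_zero_bij i ?_ ?_ ?_
  · exact fun y y' hyy => Subtype.ext (φ.symm.inj (hi y) (hyy ▸ hi y'))
  · intro x hx
    cases hφ : φ x with
    | none => exact (Function.mem_support.1 hx (by rw [hφ]; rfl)).elim
    | some y =>
      have hy : φ.symm y = some x := φ.eq_some_iff.2 hφ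
      have hys : y ∈ Function.support fun y => (φ.symm y).elim 0 fun x => inner ℂ (g y) (h x) := by
        rw [Function.mem_support, hφ] at hx
        rw [Function.mem_support, hy]
        exact hx
      exact ⟨⟨y, hys⟩, Option.some_injective _ ((hi ⟨y, hys⟩).symm.trans hy)⟩
  · intro y
    rw [hi y, φ.eq_some_iff.1 (hi y)]
    rfl

end PEquiv

/-! ### The boundary path representation and nonvanishing of vertex projections. -/

namespace KGraph

variable {k : ℕ} {V : Type u} [Category.{v} V] (Λ : KGraph k V)

/-- The space of boundary paths of `Λ`. -/
abbrev Boundary : Type (max u v) := Σ x : V, {U : Set (Λ.PathsTo x) // Λ.IsBoundary U}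

/-- The partial bijection `U ↦ f U` of the space of boundary paths. -/
def shift {a b : V} (f : a ⟶ b) : Λ.Boundary ≃. Λ.Boundary :=
  PEquiv.ofRel (fun y y' => ∃ U U', y = ⟨a, U⟩ ∧ y' = ⟨b, U'⟩ ∧ U'.1 = Λ.extendBy f U.1)
    (by
      rintro _ _ _ ⟨U, U', rfl, rfl, h⟩ ⟨U₁, U₁', h1, rfl, h2⟩
      obtain rfl := eq_of_heq (Sigma.mk.inj h1).2
      rw [Subtype.ext (h.trans h2.symm)])
    (by
      rintro _ _ _ ⟨U, U', rfl, rfl, h⟩ ⟨U₁, U₁', rfl, h1, h2⟩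
      obtain rfl := eq_of_heq (Sigma.mk.inj h1).2
      rw [Subtype.ext (extendBy_injective f U.2 U₁.2 (h.symm.trans h2))])

variable {Λ}

theorem mem_shift {a b : V} {f : a ⟶ b} {y y' : Λ.Boundary} :
    y' ∈ Λ.shift f y ↔ ∃ U U', y = ⟨a, U⟩ ∧ y' = ⟨b, U'⟩ ∧ U'.1 = Λ.extendBy f U.1 :=
  PEquiv.mem_ofRel

theorem mem_shift_id {x : V} {y y' : Λ.Boundary} :
    y' ∈ Λ.shift (𝟙 x) y ↔ y = y' ∧ y.1 = x := by
  rw [mem_shift]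
  constructor
  · rintro ⟨U, U', rfl, rfl, h⟩
    rw [extendBy_id U.2] at h
    exact ⟨by rw [Subtype.ext h], rfl⟩
  · rintro ⟨rfl, rfl⟩
    exact ⟨y.2, y.2, rfl, rfl, (extendBy_id y.2.2).symm⟩

theorem shift_comp (hΛ : Λ.LocallyConvex) {a b c : V} (ν : a ⟶ b) (μ : b ⟶ c) :
    (Λ.shift ν).trans (Λ.shift μ) = Λ.shift (ν ≫ μ) := by
  refine PEquiv.ext fun y => Option.ext fun z => ?_
  change z ∈ (Λ.shift ν).trans (Λ.shift μ) y ↔ z ∈ Λ.shift (ν ≫ μ) y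
  rw [PEquiv.mem_trans, mem_shift]
  simp only [mem_shift]
  constructor
  · rintro ⟨_, ⟨U, U', rfl, rfl, h⟩, ⟨U₁, U₁', h1, rfl, h2⟩⟩
    obtain rfl := eq_of_heq (Sigma.mk.inj h1).2
    exact ⟨U, U₁', rfl, rfl, by rw [h2, h, extendBy_comp]⟩
  · rintro ⟨U, U', rfl, rfl, h⟩
    exact ⟨⟨b, _, U.2.extendBy hΛ ν⟩, ⟨U, _, rfl, rfl, rfl⟩, ⟨_, U', rfl, rfl, by
      rw [h, extendBy_comp]⟩⟩

theorem shift_id_symm (x : V) : (Λ.shift (𝟙 x)).symm = Λ.shift (𝟙 x) := by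
  refine PEquiv.ext fun y => Option.ext fun z => ?_
  change z ∈ (Λ.shift (𝟙 x)).symm y ↔ z ∈ Λ.shift (𝟙 x) y
  rw [PEquiv.mem_iff_mem, mem_shift_id, mem_shift_id]
  constructor <;> rintro ⟨rfl, h⟩ <;> exact ⟨rfl, h⟩

theorem shift_trans_symm (hΛ : Λ.LocallyConvex) {a b : V} (f : a ⟶ b) :
    (Λ.shift f).trans (Λ.shift f).symm = Λ.shift (𝟙 a) := by
  refine PEquiv.ext fun y => Option.ext fun z => ?_
  change z ∈ (Λ.shift f).trans (Λ.shift f).symm y ↔ z ∈ Λ.shift (𝟙 a) y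
  rw [PEquiv.mem_trans, mem_shift_id]
  simp only [PEquiv.mem_iff_mem]
  constructor
  · rintro ⟨w, h, h'⟩
    obtain ⟨U, U', rfl, -⟩ := mem_shift.1 h
    exact ⟨(Λ.shift f).inj h h', rfl⟩
  · rintro ⟨rfl, rfl⟩
    have h : (⟨b, _, y.2.2.extendBy hΛ f⟩ : Λ.Boundary) ∈ Λ.shift f y :=
      mem_shift.2 ⟨y.2, _, rfl, rfl, rfl⟩
    exact ⟨_, h, h⟩

/-- Identifies the range projection of `p` as the projection onto the boundary paths that begin with
`p`, as needed for `ck4`. -/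
theorem mem_symm_trans_shift {x : V} {p : Λ.PathsTo x} {y z : Λ.Boundary} :
    z ∈ (Λ.shift p.2).symm.trans (Λ.shift p.2) y ↔
      y = z ∧ ∃ W, y = ⟨x, W⟩ ∧ p ∈ W.1 := by
  rw [PEquiv.mem_trans]
  simp only [PEquiv.mem_iff_mem]
  constructor
  · rintro ⟨w, h, h'⟩
    refine ⟨Option.mem_unique h h', ?_⟩
    obtain ⟨U, U', -, rfl, hU⟩ := mem_shift.1 h
    exact ⟨U', rfl, by rw [hU]; exact mem_extendBy_self p.2 U.2⟩
  · rintro ⟨rfl, W, rfl, hp⟩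
    obtain ⟨U, hU, hUW⟩ := W.2.exists_eq_extendBy hp
    have h : (⟨x, W⟩ : Λ.Boundary) ∈ Λ.shift p.2 ⟨p.1, U, hU⟩ :=
      mem_shift.2 ⟨_, _, rfl, rfl, hUW.symm⟩
    exact ⟨_, h, h⟩

/-- The Cuntz–Krieger family on `ℓ²` of the boundary path space. -/
def boundaryFamily (hΛ : Λ.LocallyConvex) (hrow : Λ.RowFinite) :
    Λ.CKFamily (lp (fun _ : Λ.Boundary => ℂ) 2 →L[ℂ] lp (fun _ : Λ.Boundary => ℂ) 2) :=
  have comp : ∀ {a b c : V} (ν : a ⟶ b) (μ : b ⟶ c),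
      (Λ.shift μ).toCLM * (Λ.shift ν).toCLM = (Λ.shift (ν ≫ μ)).toCLM := fun ν μ => by
    rw [← PEquiv.toCLM_trans, shift_comp hΛ]
  have star_mul : ∀ {a b : V} (f : a ⟶ b),
      star (Λ.shift f).toCLM * (Λ.shift f).toCLM = (Λ.shift (𝟙 a)).toCLM := fun f => by
    rw [PEquiv.star_toCLM, ← PEquiv.toCLM_trans, shift_trans_symm hΛ]
  { s := fun f => (Λ.shift f).toCLM
    partialIsometry := fun f => by
      rw [mul_assoc, star_mul, comp, Category.id_comp]
    ck1_proj := fun x =>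
      { isIdempotentElem := by
          change _ * _ = _
          rw [comp, Category.id_comp]
        isSelfAdjoint := by
          change star _ = _
          rw [PEquiv.star_toCLM, shift_id_symm] }
    ck1_orth := fun x y hxy => by
      rw [← PEquiv.toCLM_trans]
      refine ContinuousLinearMap.ext fun g => lp.ext (funext fun z => ?_)
      refine PEquiv.push_of_forall_notMem (fun w hw => ?_) _
      obtain ⟨t, h1, h2⟩ := (PEquiv.mem_trans _ _ _ _).1 hw
      obtain ⟨rfl, h3⟩ := mem_shift_id.1 h1
      exact hxy ((mem_shift_id.1 h2).2.symm.trans h3)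
    ck2 := comp
    ck3 := star_mul
    ck4 := fun x n => by
      rw [finsum_mem_eq_finite_toFinset_sum _ (Λ.pathsLE_finite hrow x n)]
      simp only [PEquiv.star_toCLM, ← PEquiv.toCLM_trans]
      refine ContinuousLinearMap.ext fun g => lp.ext (funext fun z => ?_)
      rw [_root_.sum_apply, lp.coeFn_sum, Finset.sum_apply]
      simp only [PEquiv.toCLM_apply]
      by_cases hz : z.1 = x
      · subst hz
        -- A boundary path begins with exactly one element of `xΛ^{≤ n}`: `meets` gives existence,
        -- and directedness with `eq_of_mem_pathsLE` gives uniqueness. So one term of the sum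
        -- survives.
        obtain ⟨p, hp, hpn⟩ := z.2.2.meets n
        rw [PEquiv.push_of_mem (mem_shift_id.2 ⟨rfl, rfl⟩), Finset.sum_eq_single p,
          PEquiv.push_of_mem (mem_symm_trans_shift.2 ⟨rfl, z.2, rfl, hp⟩)]
        · intro q hq hqp
          refine PEquiv.push_of_forall_notMem (fun w hw => hqp ?_) _
          obtain ⟨rfl, W, hW, hqW⟩ := mem_symm_trans_shift.1 hw
          obtain ⟨_, W'⟩ := w
          obtain rfl := eq_of_heq (Sigma.mk.inj hW).2
          obtain ⟨r, -, h1, h2⟩ := W'.2.directed hqW hp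
          exact eq_of_mem_pathsLE ((Λ.pathsLE_finite hrow _ n).mem_toFinset.1 hq) hpn h1 h2
        · exact fun h => (h ((Λ.pathsLE_finite hrow _ n).mem_toFinset.2 hpn)).elim
      · rw [PEquiv.push_of_forall_notMem, Finset.sum_eq_zero]
        · intro p _
          refine PEquiv.push_of_forall_notMem (fun w hw => ?_) _
          obtain ⟨rfl, W, rfl, -⟩ := mem_symm_trans_shift.1 hw
          exact hz rfl
        · intro w hw
          obtain ⟨rfl, h⟩ := mem_shift_id.1 hw
          exact hz h }

/-- The vertex projections of the C⋆-algebra of a locally convex row-finite graph are nonzero. -/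
theorem vertexProj_ne_zero (hΛ : Λ.LocallyConvex) (hrow : Λ.RowFinite) (x : V) :
    Λ.vertexProj x ≠ 0 := by
  classical
  intro h0
  have h1 := congrArg (Λ.lift (boundaryFamily hΛ hrow)) h0
  rw [map_zero, vertexProj, lift_gen] at h1
  obtain ⟨U, hU⟩ := hΛ.exists_isBoundary hrow x
  -- The basis vector of a boundary path at `x` is fixed by the image of `p_x`, which is therefore
  -- nonzero.
  let y : Λ.Boundary := ⟨x, U, hU⟩
  have h2 := congrArg (fun T => T (lp.single 2 y (1 : ℂ)) y) h1
  change (Λ.shift (𝟙 x)).push _ y = 0 at h2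
  have h3 : (lp.single 2 y (1 : ℂ) : lp (fun _ : Λ.Boundary => ℂ) 2) y = 0 :=
    (PEquiv.push_of_mem (φ := Λ.shift (𝟙 x)) (x := y) (mem_shift_id.2 ⟨rfl, rfl⟩) _).symm.trans h2
  simp at h3

end KGraph

/-! ### Approximate unit of vertex projections and the identity `τ ∘ Φ = τ`. -/

/-- Lower semicontinuity speaks of sequences; by metrizability this closure form also serves limits
over the directed set of finite vertex sets. -/
theorem CStarTrace.IsLowerSemicontinuous.apply_le_of_mem_closure {A : Type w}
    [NonUnitalCStarAlgebra A] [PartialOrder A] [StarOrderedRing A] {τ : CStarTrace A}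
    (h : τ.IsLowerSemicontinuous) {C : ℝ≥0∞} {a : {a : A // 0 ≤ a}}
    (ha : a ∈ closure {b | τ b ≤ C}) : τ a ≤ C := by
  obtain ⟨x, hx, hxa⟩ := mem_closure_iff_seq_limit.1 ha
  refine (h x a hxa).trans ((liminf_le_liminf (v := fun _ => C) (Eventually.of_forall hx)).trans ?_)
  rw [liminf_const]

namespace KGraph

variable {k : ℕ} {V : Type u} [Category.{v} V] {Λ : KGraph k V}

/-- A closed ⋆-subalgebra of `C⋆(Λ)` that contains the generators is everything. -/
theorem mem_of_forall_gen_mem (S : NonUnitalStarSubalgebra ℂ Λ.CStar)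
    (hS : IsClosed (S : Set Λ.CStar)) (hgen : ∀ {a b : V} (f : a ⟶ b), Λ.gen f ∈ S)
    (x : Λ.CStar) : x ∈ S := by
  have hiso : Isometry Λ.incl := isometry_subtype_coe
  have hcl : IsClosed (S.map Λ.incl : Set Λ.BigAlg) := by
    rw [NonUnitalStarSubalgebra.coe_map]
    exact hiso.isClosedEmbedding.isClosedMap _ hS
  have hle : Λ.algSub ≤ S.map Λ.incl := by
    refine NonUnitalStarSubalgebra.topologicalClosure_minimal _
      (NonUnitalStarAlgebra.adjoin_le ?_) hcl
    rintro _ ⟨f, rfl⟩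
    exact ⟨Λ.gen f.2.2, hgen f.2.2, rfl⟩
  obtain ⟨y, hy, hyx⟩ := hle x.2
  rwa [← hiso.injective hyx]

theorem norm_gauge_le (z : Fin k → Circle) (a : Λ.CStar) : ‖Λ.gauge z a‖ ≤ ‖a‖ :=
  NonUnitalStarAlgHom.norm_apply_le (Λ.gauge z) a

/-- Elements with continuous orbit map form a ⋆-subalgebra, closed because each `γ_z` is
contractive, and it contains the generators. -/
theorem continuous_gauge (a : Λ.CStar) : Continuous fun z => Λ.gauge z a := by
  let S : NonUnitalStarSubalgebra ℂ Λ.CStar :=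
    { carrier := {a | Continuous fun z => Λ.gauge z a}
      add_mem' := fun {a b} (ha : Continuous _) (hb : Continuous _) => by
        change Continuous fun z => Λ.gauge z (a + b)
        simp only [map_add]
        exact ha.add hb
      zero_mem' := by
        change Continuous fun z => Λ.gauge z 0
        simp only [map_zero]
        exact continuous_const
      mul_mem' := fun {a b} (ha : Continuous _) (hb : Continuous _) => by
        change Continuous fun z => Λ.gauge z (a * b)
        simp only [map_mul]
        exact ha.mul hb
      smul_mem' := fun c a (ha : Continuous _) => by
        change Continuous fun z => Λ.gauge z (c • a)
        simp only [map_smul]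
        exact ha.const_smul c
      star_mem' := fun {a} (ha : Continuous _) => by
        change Continuous fun z => Λ.gauge z (star a)
        simp only [map_star]
        exact ha.star }
  refine mem_of_forall_gen_mem S (isClosed_of_closure_subset fun x hx => ?_) (fun f => ?_) a
  · refine continuous_of_uniform_approx_of_continuous fun U hU => ?_
    obtain ⟨ε, hε, hεU⟩ := Metric.mem_uniformity_dist.1 hU
    obtain ⟨y, hy, hxy⟩ := Metric.mem_closure_iff.1 hx ε hε
    refine ⟨fun z => Λ.gauge z y, hy, fun z => hεU ?_⟩
    rw [dist_eq_norm, ← map_sub]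
    refine (norm_gauge_le z _).trans_lt ?_
    rwa [← dist_eq_norm]
  · change Continuous fun z => Λ.gauge z (Λ.gen f)
    simp only [gauge_gen, torusPow]
    have h : Continuous fun z : Fin k → Circle => ∏ i, z i ^ Λ.deg f i := by fun_prop
    exact (continuous_subtype_val.comp h).smul continuous_const

instance isProbabilityMeasure_torusHaar : IsProbabilityMeasure (torusHaar k) where
  measure_univ := by
    have := Measure.haarMeasure_self (K₀ := (⊤ : TopologicalSpace.PositiveCompacts
      (Fin k → Circle)))
    rwa [TopologicalSpace.PositiveCompacts.coe_top] at this

theorem integrable_gauge (a : Λ.CStar) : Integrable (fun z => Λ.gauge z a) (torusHaar k) :=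
  (continuous_gauge a).integrable_of_hasCompactSupport (HasCompactSupport.of_compactSpace _)

variable (Λ) in
/-- The sum of finitely many vertex projections. -/
def vertexSum (F : Finset V) : Λ.CStar := ∑ x ∈ F, Λ.vertexProj x

theorem gauge_vertexSum (z : Fin k → Circle) (F : Finset V) :
    Λ.gauge z (Λ.vertexSum F) = Λ.vertexSum F := by
  simp [vertexSum, map_sum, vertexProj, gauge_gen, torusPow, Λ.deg_id]

theorem isStarProjection_vertexProj (hrow : Λ.RowFinite) (x : V) :
    IsStarProjection (Λ.vertexProj x) := (Λ.genFamily hrow).ck1_proj x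

theorem vertexProj_mul_vertexProj (hrow : Λ.RowFinite) {x y : V} (h : x ≠ y) :
    Λ.vertexProj x * Λ.vertexProj y = 0 := (Λ.genFamily hrow).ck1_orth x y h

theorem gen_mul_gen (hrow : Λ.RowFinite) {a b c : V} (ν : a ⟶ b) (μ : b ⟶ c) :
    Λ.gen μ * Λ.gen ν = Λ.gen (ν ≫ μ) := (Λ.genFamily hrow).ck2 ν μ

theorem star_gen_mul_gen (hrow : Λ.RowFinite) {a b : V} (f : a ⟶ b) :
    star (Λ.gen f) * Λ.gen f = Λ.vertexProj a := (Λ.genFamily hrow).ck3 f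

theorem vertexProj_mul_gen (hrow : Λ.RowFinite) {a b : V} (f : a ⟶ b) :
    Λ.vertexProj b * Λ.gen f = Λ.gen f := by
  rw [vertexProj, gen_mul_gen hrow, Category.comp_id]

theorem gen_mul_vertexProj (hrow : Λ.RowFinite) {a b : V} (f : a ⟶ b) :
    Λ.gen f * Λ.vertexProj a = Λ.gen f := by
  rw [vertexProj, gen_mul_gen hrow, Category.id_comp]

theorem isStarProjection_vertexSum (hrow : Λ.RowFinite) (F : Finset V) :
    IsStarProjection (Λ.vertexSum F) where
  isIdempotentElem := by
    change _ * _ = _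
    rw [vertexSum, Finset.sum_mul_sum]
    refine Finset.sum_congr rfl fun x hx => ?_
    rw [Finset.sum_eq_single x (fun y _ hy => vertexProj_mul_vertexProj hrow hy.symm)
      fun h => (h hx).elim]
    exact (isStarProjection_vertexProj hrow x).isIdempotentElem
  isSelfAdjoint := by
    change star _ = _
    rw [vertexSum, star_sum]
    exact Finset.sum_congr rfl fun x _ => (isStarProjection_vertexProj hrow x).isSelfAdjoint

theorem vertexSum_mul_vertexProj (hrow : Λ.RowFinite) {F : Finset V} {x : V} (hx : x ∈ F) :
    Λ.vertexSum F * Λ.vertexProj x = Λ.vertexProj x := by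
  rw [vertexSum, Finset.sum_mul, Finset.sum_eq_single x
    (fun y _ hy => vertexProj_mul_vertexProj hrow hy) fun h => (h hx).elim]
  exact (isStarProjection_vertexProj hrow x).isIdempotentElem

theorem norm_vertexSum_le (hrow : Λ.RowFinite) (F : Finset V) : ‖Λ.vertexSum F‖ ≤ 1 :=
  (isStarProjection_vertexSum hrow F).norm_le

/-- The sums of vertex projections form an approximate unit. -/
theorem tendsto_vertexSum_mul (hrow : Λ.RowFinite) (a : Λ.CStar) :
    Tendsto (fun F => Λ.vertexSum F * a) atTop (𝓝 a) := by
  let P : Λ.CStar → Prop := fun a => Tendsto (fun F => Λ.vertexSum F * a) atTop (𝓝 a)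
  have hadd : ∀ {a b}, P a → P b → P (a + b) := fun {a b} ha hb => by
    simpa only [P, mul_add] using Tendsto.add ha hb
  have hmul : ∀ {a b}, P a → P (a * b) := fun {a b} ha => by
    simpa only [P, mul_assoc] using Tendsto.mul_const b ha
  have hsmul : ∀ (c : ℂ) {a}, P a → P (c • a) := fun c {a} ha => by
    simpa only [P, mul_smul_comm] using Tendsto.const_smul ha c
  have hzero : P 0 := by simp [P]
  have hcl : IsClosed {a | P a} := by
    refine isClosed_of_closure_subset fun x hx => ?_
    refine Metric.tendsto_nhds.2 fun ε hε => ?_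
    obtain ⟨y, hy, hxy⟩ := Metric.mem_closure_iff.1 hx (ε / 3) (by positivity)
    filter_upwards [Metric.tendsto_nhds.1 hy (ε / 3) (by positivity)] with F hF
    have h1 : dist (Λ.vertexSum F * x) (Λ.vertexSum F * y) < ε / 3 := by
      rw [dist_eq_norm, ← mul_sub]
      refine (norm_mul_le _ _).trans_lt ?_
      rw [dist_eq_norm] at hxy
      nlinarith [norm_vertexSum_le hrow F, norm_nonneg (x - y)]
    have h2 := dist_triangle4 (Λ.vertexSum F * x) (Λ.vertexSum F * y) y x
    rw [dist_comm y x] at h2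
    linarith
  -- The set of `a` satisfying `P` is a closed right ideal, not obviously stable under `star`;
  -- imposing `P` on `star a` as well repairs this.
  let S : NonUnitalStarSubalgebra ℂ Λ.CStar :=
    { carrier := {a | P a ∧ P (star a)}
      add_mem' := fun ha hb => ⟨hadd ha.1 hb.1, by rw [star_add]; exact hadd ha.2 hb.2⟩
      zero_mem' := ⟨hzero, by rw [star_zero]; exact hzero⟩
      mul_mem' := fun ha hb => ⟨hmul ha.1, by rw [star_mul]; exact hmul hb.2⟩
      smul_mem' := fun c a ha => ⟨hsmul c ha.1, by rw [star_smul]; exact hsmul _ ha.2⟩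
      star_mem' := fun ha => ⟨ha.2, by rw [star_star]; exact ha.1⟩ }
  have hev : ∀ (x : V) {b : Λ.CStar}, Λ.vertexProj x * b = b → P b := fun x b hb => by
    refine tendsto_const_nhds.congr' ?_
    filter_upwards [eventually_ge_atTop {x}] with F hF
    rw [← hb, ← mul_assoc, vertexSum_mul_vertexProj hrow (hF (Finset.mem_singleton_self x))]
  refine (mem_of_forall_gen_mem S (hcl.inter (hcl.preimage continuous_star))
    (fun {x y} f => ⟨hev y (vertexProj_mul_gen hrow f), hev x ?_⟩) a).1
  have := congrArg star (gen_mul_vertexProj hrow f)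
  rwa [star_mul, (isStarProjection_vertexProj hrow x).isSelfAdjoint.star_eq] at this

theorem tendsto_vertexSum_conj (hrow : Λ.RowFinite) (a : Λ.CStar) :
    Tendsto (fun F => Λ.vertexSum F * a * Λ.vertexSum F) atTop (𝓝 a) := by
  have h1 : Tendsto (fun F => a * Λ.vertexSum F) atTop (𝓝 a) := by
    have := (tendsto_vertexSum_mul hrow (star a)).star
    simpa only [star_mul, star_star,
      (isStarProjection_vertexSum hrow _).isSelfAdjoint.star_eq] using this
  have h2 : Tendsto (fun F => Λ.vertexSum F * (a * Λ.vertexSum F - a)) atTop (𝓝 0) := by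
    refine squeeze_zero_norm (a := fun F => ‖a * Λ.vertexSum F - a‖) (fun F => ?_) ?_
    · refine (norm_mul_le _ _).trans ?_
      exact mul_le_of_le_one_left (norm_nonneg _) (norm_vertexSum_le hrow F)
    · simpa using (h1.sub_const a).norm
  refine ((tendsto_vertexSum_mul hrow a).add h2).congr (fun F => ?_) |>.trans (by simp)
  rw [mul_sub, mul_assoc]
  abel

theorem vertexSum_conj_nonneg (hrow : Λ.RowFinite) (F : Finset V) {a : Λ.CStar} (ha : 0 ≤ a) :
    0 ≤ Λ.vertexSum F * a * Λ.vertexSum F := by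
  have := star_left_conjugate_nonneg ha (Λ.vertexSum F)
  rwa [(isStarProjection_vertexSum hrow F).isSelfAdjoint.star_eq] at this

/-- A lower semicontinuous trace is determined by its values on the corners. -/
theorem apply_le_of_forall_vertexSum (hrow : Λ.RowFinite) {τ : CStarTrace Λ.CStar}
    (hlsc : τ.IsLowerSemicontinuous) {a : Λ.CStar} (ha : 0 ≤ a) {C : ℝ≥0∞}
    (h : ∀ F, τ ⟨_, vertexSum_conj_nonneg hrow F ha⟩ ≤ C) : τ ⟨a, ha⟩ ≤ C := by
  refine hlsc.apply_le_of_mem_closure (mem_closure_of_tendsto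
    (f := fun F => ⟨_, vertexSum_conj_nonneg hrow F ha⟩) (b := atTop) ?_
    (Eventually.of_forall h))
  exact tendsto_subtype_rng.2 (tendsto_vertexSum_conj hrow a)

/-- On the corner `τ` is a bounded functional and commutes with the integral. Since `γ_z` fixes
`p_F`, the integrand is constant, and the measure has mass one. -/
theorem apply_corner_Phi (hrow : Λ.RowFinite) {τ : CStarTrace Λ.CStar}
    (hinv : Λ.IsGaugeInvariant τ) (hsf : τ.IsSemifinite) (F : Finset V) {a : Λ.CStar}
    (ha : 0 ≤ a) :
    τ ⟨_, vertexSum_conj_nonneg hrow F (Λ.Phi_nonneg ha)⟩ =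
      τ ⟨_, vertexSum_conj_nonneg hrow F ha⟩ := by
  have hp := isStarProjection_vertexSum hrow F
  have hτ := hsf.apply_projection_lt_top hp hp.nonneg
  obtain ⟨φ, hφ⟩ := τ.exists_corner_functional hp hτ
  have h1 : φ (Λ.Phi a) = φ a := by
    rw [Phi, ← φ.integral_comp_comm (integrable_gauge a)]
    have : ∀ z, φ (Λ.gauge z a) = φ a := fun z => by
      rw [hφ _ (Λ.gauge_nonneg z ha) (vertexSum_conj_nonneg hrow F (Λ.gauge_nonneg z ha)),
        hφ a ha (vertexSum_conj_nonneg hrow F ha),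
        ← hinv z ⟨_, vertexSum_conj_nonneg hrow F ha⟩]
      congr 2
      refine τ.apply_congr _ ?_
      simp only [map_mul, gauge_vertexSum]
    simp [this]
  rw [hφ _ (Λ.Phi_nonneg ha) (vertexSum_conj_nonneg hrow F (Λ.Phi_nonneg ha)),
    hφ a ha (vertexSum_conj_nonneg hrow F ha)] at h1
  have hfin : ∀ {b : Λ.CStar} (hb : 0 ≤ b), τ ⟨_, vertexSum_conj_nonneg hrow F hb⟩ ≠ ∞ :=
    fun hb => ((τ.apply_corner_le hp hb _).trans_lt (ENNReal.mul_lt_top ENNReal.coe_lt_top hτ)).ne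
  exact (ENNReal.toReal_eq_toReal_iff' (hfin (Λ.Phi_nonneg ha)) (hfin ha)).1 (by exact_mod_cast h1)

/-- A gauge-invariant semifinite lower semicontinuous trace satisfies `τ ∘ Φ = τ`. -/
theorem apply_Phi (hrow : Λ.RowFinite) {τ : CStarTrace Λ.CStar}
    (hinv : Λ.IsGaugeInvariant τ) (hsf : τ.IsSemifinite) (hlsc : τ.IsLowerSemicontinuous)
    {a : Λ.CStar} (ha : 0 ≤ a) : τ ⟨Λ.Phi a, Λ.Phi_nonneg ha⟩ = τ ⟨a, ha⟩ := by
  refine le_antisymm (apply_le_of_forall_vertexSum hrow hlsc _ fun F => ?_)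
    (apply_le_of_forall_vertexSum hrow hlsc ha fun F => ?_)
  · rw [apply_corner_Phi hrow hinv hsf F ha]
    exact τ.apply_conj_le (isStarProjection_vertexSum hrow F) ha _
  · rw [← apply_corner_Phi hrow hinv hsf F ha]
    exact τ.apply_conj_le (isStarProjection_vertexSum hrow F) _ _

end KGraph

/-! ### Loops with an entrance, values on `s_μ s_ν⋆`, and vanishing on the diagonal. -/

namespace KGraph

variable {k : ℕ} {V : Type u} [Category.{v} V] {Λ : KGraph k V}

theorem vertexProj_eq_sum (hrow : Λ.RowFinite) (x : V) (n : Fin k → ℕ) :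
    Λ.vertexProj x =
      ∑ p ∈ (Λ.pathsLE_finite hrow x n).toFinset, Λ.gen p.2 * star (Λ.gen p.2) :=
  ((Λ.genFamily hrow).ck4 x n).trans (finsum_mem_eq_finite_toFinset_sum _ _)

theorem add_le_vertexProj (hrow : Λ.RowFinite) {x : V} {n : Fin k → ℕ} {p q : Λ.PathsTo x}
    (hp : p ∈ Λ.pathsLE x n) (hq : q ∈ Λ.pathsLE x n) (hpq : p ≠ q) :
    Λ.gen p.2 * star (Λ.gen p.2) + Λ.gen q.2 * star (Λ.gen q.2) ≤ Λ.vertexProj x := by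
  classical
  rw [vertexProj_eq_sum hrow x n,
    ← Finset.sum_pair hpq (f := fun p : Λ.PathsTo x => Λ.gen p.2 * star (Λ.gen p.2))]
  refine Finset.sum_le_sum_of_subset_of_nonneg (fun r hr => ?_)
    fun r _ _ => mul_star_self_nonneg _
  rw [Set.Finite.mem_toFinset]
  rcases Finset.mem_insert.1 hr with rfl | hr
  · exact hp
  · rwa [Finset.mem_singleton.1 hr]

/-- The range projections of distinct elements of `vΛ^{≤ n}` are orthogonal. -/
theorem star_gen_mul_gen_eq_zero (hrow : Λ.RowFinite) {x : V} {n : Fin k → ℕ}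
    {p q : Λ.PathsTo x} (hp : p ∈ Λ.pathsLE x n) (hq : q ∈ Λ.pathsLE x n) (hpq : p ≠ q) :
    star (Λ.gen q.2) * Λ.gen p.2 = 0 := by
  -- Conjugating `s_p s_p⋆ + s_q s_q⋆ ≤ p_x` by `s_p` gives `p_{s(p)} + (s_q⋆ s_p)⋆(s_q⋆ s_p) ≤
  -- p_{s(p)}`, which forces the second term to vanish.
  have h1 := star_left_conjugate_le_conjugate (add_le_vertexProj hrow hp hq hpq) (Λ.gen p.2)
  have h2 : star (Λ.gen p.2) * Λ.vertexProj x * Λ.gen p.2 = star (Λ.gen p.2) * Λ.gen p.2 := by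
    rw [mul_assoc, vertexProj_mul_gen hrow]
  have h3 : star (Λ.gen p.2) * (Λ.gen p.2 * star (Λ.gen p.2)) * Λ.gen p.2 =
      star (Λ.gen p.2) * Λ.gen p.2 := by
    rw [← mul_assoc, mul_assoc, star_gen_mul_gen hrow]
    exact (isStarProjection_vertexProj hrow p.1).isIdempotentElem
  have h4 : star (Λ.gen p.2) * (Λ.gen q.2 * star (Λ.gen q.2)) * Λ.gen p.2 =
      star (star (Λ.gen q.2) * Λ.gen p.2) * (star (Λ.gen q.2) * Λ.gen p.2) := by
    simp only [star_mul, star_star, mul_assoc]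
  rw [mul_add, add_mul, h2, h3, h4, add_le_iff_nonpos_right] at h1
  exact CStarRing.star_mul_self_eq_zero_iff _ |>.1 (le_antisymm h1 (star_mul_self_nonneg _))

/-- If `C⋆(Λ)` has a faithful semifinite trace, then no loop in `Λ` has an entrance. -/
theorem not_hasEntrance_of_trace (hrow : Λ.RowFinite) (hΛ : Λ.LocallyConvex)
    {τ : CStarTrace Λ.CStar} (hfaith : τ.IsFaithful) (hsf : τ.IsSemifinite) {x : V} (f : x ⟶ x) :
    ¬ Λ.HasEntrance f := by
  rintro ⟨i, -, e, he, α, β, hα, rfl, hne⟩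
  have hproj := isStarProjection_vertexProj hrow x
  have hfin := hsf.apply_projection_lt_top hproj hproj.nonneg
  -- For the loop `f = αβ`, `p_x = s_f⋆ s_f` has the trace of `s_f s_f⋆`, and this range projection
  -- lies below that of `α`.
  have hloop : τ ⟨Λ.vertexProj x, hproj.nonneg⟩ ≤
      τ ⟨Λ.gen α.2 * star (Λ.gen α.2), mul_star_self_nonneg _⟩ := by
    have h1 : Λ.gen (β ≫ α.2) * star (Λ.gen (β ≫ α.2)) =
        Λ.gen α.2 * (Λ.gen β * star (Λ.gen β)) * star (Λ.gen α.2) := by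
      rw [← gen_mul_gen hrow, star_mul]
      simp only [mul_assoc]
    have h2 : Λ.gen β * star (Λ.gen β) ≤ Λ.vertexProj α.1 := by
      rw [vertexProj_eq_sum hrow α.1 (Λ.deg β)]
      exact Finset.single_le_sum (f := fun p : Λ.PathsTo α.1 => Λ.gen p.2 * star (Λ.gen p.2))
        (fun p _ => mul_star_self_nonneg _)
        ((Set.Finite.mem_toFinset _).2 (mem_pathsLE_deg ⟨x, β⟩))
    have h3 := star_right_conjugate_le_conjugate h2 (Λ.gen α.2)
    rw [← h1, gen_mul_vertexProj hrow] at h3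
    rw [τ.apply_congr hproj.nonneg (star_gen_mul_gen hrow (β ≫ α.2)).symm, τ.map_star_mul']
    exact τ.apply_mono _ h3
  have hle := τ.apply_mono (add_nonneg (mul_star_self_nonneg _) (mul_star_self_nonneg _))
    (add_le_vertexProj hrow (hα ▸ mem_pathsLE_deg α) (he ▸ mem_pathsLE_deg e) hne)
  rw [τ.apply_add (mul_star_self_nonneg _) (mul_star_self_nonneg _)] at hle
  -- From `τ(p_x) + τ(s_e s_e⋆) ≤ τ(p_x)`, where finiteness of `τ(p_x)` permits cancellation.
  have hzero : τ ⟨Λ.gen e.2 * star (Λ.gen e.2), mul_star_self_nonneg _⟩ = 0 := by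
    have h := (add_le_add_left hloop _).trans hle
    by_contra h0
    exact (ENNReal.lt_add_right hfin.ne h0).not_ge h
  rw [← τ.map_star_mul'] at hzero
  refine vertexProj_ne_zero hΛ hrow e.1 ?_
  rw [← star_gen_mul_gen hrow e.2, hfaith _ hzero, mul_zero]

theorem apply_gen_mul_star (hrow : Λ.RowFinite) (τ : CStarTrace Λ.CStar) {a b : V} (f : a ⟶ b) :
    τ ⟨Λ.gen f * star (Λ.gen f), mul_star_self_nonneg _⟩ =
      τ ⟨Λ.vertexProj a, (isStarProjection_vertexProj hrow a).nonneg⟩ := by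
  rw [← τ.map_star_mul']
  exact τ.apply_congr _ (star_gen_mul_gen hrow f)

/-- Carries gauge invariance from positive elements to the linear extension. -/
theorem gauge_mem_graphSpan {τ : CStarTrace Λ.CStar} (hinv : Λ.IsGaugeInvariant τ)
    (z : Fin k → Circle) {x : Λ.CStar × ℂ} (hx : x ∈ τ.graphSpan) :
    (Λ.gauge z x.1, x.2) ∈ τ.graphSpan := by
  induction hx using Submodule.span_induction with
  | mem x hx =>
    obtain ⟨a, ha, rfl⟩ := hx
    rw [← hinv z a] at ha ⊢
    exact Submodule.subset_span ⟨_, ha, rfl⟩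
  | zero =>
    rw [Prod.fst_zero, map_zero]
    exact zero_mem τ.graphSpan
  | add x y _ _ hx hy => simpa using add_mem hx hy
  | smul c x _ hx => simpa using Submodule.smul_mem _ c hx

/-- With angle `1/(m + n + 1)` both powers have angle in `[0, 1]`, inside the principal range, so
the argument recovers the exponent. -/
theorem exists_circle_pow_ne {m n : ℕ} (h : m ≠ n) : ∃ ζ : Circle, ζ ^ m ≠ ζ ^ n := by
  have hpos : (0 : ℝ) < m + n + 1 := by positivity
  have hpi := Real.pi_gt_three
  refine ⟨Circle.exp (1 / (m + n + 1)), fun he => h ?_⟩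
  have key : ∀ l : ℕ, l ≤ m + n → Complex.arg (Circle.exp (1 / ((m : ℝ) + n + 1)) ^ l : Circle) =
      l * (1 / ((m : ℝ) + n + 1)) := fun l hl => by
    have h1 : (l : ℝ) * (1 / ((m : ℝ) + n + 1)) ≤ 1 := by
      rw [mul_one_div, div_le_one hpos]
      have : (l : ℝ) ≤ m + n := by exact_mod_cast hl
      linarith
    have h2 : 0 ≤ (l : ℝ) * (1 / ((m : ℝ) + n + 1)) := by positivity
    rw [← Circle.exp_natCast_mul, Circle.arg_exp (by linarith) (by linarith)]
  have h1 := key m (by omega)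
  rw [he, key n (by omega)] at h1
  have := mul_right_cancel₀ (by positivity) h1
  exact_mod_cast this.symm

/-- The trace property moves the question to `s_ν⋆ s_μ`. This is a vertex projection if `μ = ν`, and
zero for distinct paths of equal degree, by orthogonality of range projections or of range vertices.
Different degrees are separated by the gauge action. -/
theorem extend_gen_mul_star (hrow : Λ.RowFinite) {τ : CStarTrace Λ.CStar}
    (hinv : Λ.IsGaugeInvariant τ) (hsf : τ.IsSemifinite) [DecidableEq Λ.Path] (μ ν : Λ.Path) :
    ∃ (h : Λ.gen μ.2.2 * star (Λ.gen ν.2.2) ∈ τ.extend.domain)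
      (h' : Λ.vertexProj μ.1 ∈ τ.extend.domain),
      τ.extend ⟨Λ.gen μ.2.2 * star (Λ.gen ν.2.2), h⟩ =
        if μ = ν then τ.extend ⟨Λ.vertexProj μ.1, h'⟩ else 0 := by
  have hproj := isStarProjection_vertexProj hrow μ.1
  have hfin : ∀ μ : Λ.Path, τ ⟨Λ.gen μ.2.2 * star (Λ.gen μ.2.2), mul_star_self_nonneg _⟩ < ∞ :=
    fun μ => by
      rw [apply_gen_mul_star hrow]
      exact hsf.apply_projection_lt_top (isStarProjection_vertexProj hrow μ.1) _
  obtain ⟨h, h', heq⟩ := τ.extend_mul_star (hfin μ) (hfin ν)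
  refine ⟨h, (τ.extend_coe ⟨_, hproj.nonneg⟩ (hsf.apply_projection_lt_top hproj _)).1, ?_⟩
  split_ifs with hμν
  · subst hμν
    rw [heq]
    congr 1
    exact Subtype.ext (star_gen_mul_gen hrow _)
  by_cases hd : Λ.deg μ.2.2 = Λ.deg ν.2.2
  · have h0 : star (Λ.gen ν.2.2) * Λ.gen μ.2.2 = 0 := by
      obtain ⟨a, x, f⟩ := μ
      obtain ⟨b, y, g⟩ := ν
      by_cases hxy : x = y
      · subst hxy
        refine star_gen_mul_gen_eq_zero hrow (p := ⟨a, f⟩) (q := ⟨b, g⟩) (mem_pathsLE_deg _)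
          (by rw [show Λ.deg _ = Λ.deg _ from hd]; exact mem_pathsLE_deg ⟨b, g⟩) fun hfg => hμν ?_
        exact congrArg (fun p : Λ.PathsTo x => (⟨p.1, x, p.2⟩ : Λ.Path)) hfg
      · change star (Λ.gen g) * Λ.gen f = 0
        rw [← vertexProj_mul_gen hrow f, ← vertexProj_mul_gen hrow g, star_mul,
          (isStarProjection_vertexProj hrow y).isSelfAdjoint.star_eq, mul_assoc,
          ← mul_assoc (Λ.vertexProj y), vertexProj_mul_vertexProj hrow (Ne.symm hxy), zero_mul,
          mul_zero]
    rw [heq, ← τ.extend.map_zero]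
    congr 1
    exact Subtype.ext h0
  · obtain ⟨i, hi⟩ := Function.ne_iff.1 hd
    obtain ⟨ζ, hζ⟩ := exists_circle_pow_ne hi
    -- Rotating only a coordinate `i` in which the degrees differ scales `s_μ s_ν⋆` by `w`, the
    -- power of `ζ` with exponent `d(μ)_i - d(ν)_i`. By choice of `ζ`, `w ≠ 1`, while invariance
    -- gives `w c = c`; hence `c = 0`.
    let z : Fin k → Circle := Function.update 1 i ζ
    have hz : ∀ {a b : V} (f : a ⟶ b), Λ.torusPow z f = ζ ^ Λ.deg f i := fun f => by
      rw [torusPow, Finset.prod_eq_single i]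
      · simp [z]
      · intro j _ hj
        simp [z, hj]
      · simp
    set c := τ.extend ⟨_, h⟩ with hc
    have hgraph : (Λ.gen μ.2.2 * star (Λ.gen ν.2.2), c) ∈ τ.graphSpan := by
      rw [← Submodule.toLinearPMap_graph_eq _ τ.snd_eq_zero_of_mem_graphSpan]
      exact LinearPMap.mem_graph _ ⟨_, h⟩
    have hgauge := gauge_mem_graphSpan hinv z hgraph
    obtain ⟨h1, h2⟩ := τ.extend_of_mem_graphSpan hgauge
    let w : ℂ := (ζ ^ Λ.deg μ.2.2 i : Circle) * star ((ζ ^ Λ.deg ν.2.2 i : Circle) : ℂ)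
    have hw : Λ.gauge z (Λ.gen μ.2.2 * star (Λ.gen ν.2.2)) =
        w • (Λ.gen μ.2.2 * star (Λ.gen ν.2.2)) := by
      rw [map_mul, map_star, gauge_gen, gauge_gen, hz, hz, star_smul, smul_mul_smul_comm]
    have hwc : w * c = c := by
      refine Eq.trans ?_ h2
      rw [hc, ← smul_eq_mul, ← LinearPMap.map_smul]
      congr 1
      exact Subtype.ext hw.symm
    have hw1 : w ≠ 1 := fun hw1 => hζ <| by
      have h3 : (ζ ^ Λ.deg μ.2.2 i) * (ζ ^ Λ.deg ν.2.2 i)⁻¹ = 1 := by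
        ext
        rw [Circle.coe_mul, Circle.coe_inv_eq_conj]
        exact hw1
      exact mul_inv_eq_one.1 h3
    by_contra hc0
    exact hw1 (mul_right_cancel₀ hc0 (hwc.trans (one_mul c).symm))

theorem vertexProj_mem_diagonal (hrow : Λ.RowFinite) (x : V) :
    Λ.vertexProj x ∈ Λ.diagonal := by
  have h : Λ.gen (𝟙 x) * star (Λ.gen (𝟙 x)) = Λ.vertexProj x := by
    have hp := isStarProjection_vertexProj hrow x
    exact (congrArg _ hp.isSelfAdjoint.star_eq).trans hp.isIdempotentElem
  rw [← h]
  exact NonUnitalStarSubalgebra.le_topologicalClosure _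
    (NonUnitalStarAlgebra.subset_adjoin ℂ _ ⟨⟨x, x, 𝟙 x⟩, rfl⟩)

/-- A lower semicontinuous trace that vanishes on the diagonal is zero. -/
theorem eq_zero_of_forall_diagonal (hrow : Λ.RowFinite) {τ : CStarTrace Λ.CStar}
    (hlsc : τ.IsLowerSemicontinuous)
    (h : ∀ a : {a : Λ.CStar // 0 ≤ a}, (a : Λ.CStar) ∈ Λ.diagonal → τ a = 0)
    (a : {a : Λ.CStar // 0 ≤ a}) : τ a = 0 := by
  refine le_antisymm (apply_le_of_forall_vertexSum hrow hlsc a.2 fun F => ?_) bot_le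
  have hp := isStarProjection_vertexSum hrow F
  refine (τ.apply_corner_le hp a.2 _).trans ?_
  rw [h ⟨_, hp.nonneg⟩ (sum_mem fun x _ => vertexProj_mem_diagonal hrow x), mul_zero]

end KGraph

end

theorem lemma3p3 {k : ℕ} {V : Type u} [Category.{v} V] (Λ : KGraph k V)
    (hrow : Λ.RowFinite) (hconv : Λ.LocallyConvex) [DecidableEq Λ.Path] :
    ((∃ τ : CStarTrace Λ.CStar, τ.IsFaithful ∧ τ.IsSemifinite) →
      ∀ (x : V) (f : x ⟶ x), ¬ Λ.HasEntrance f) ∧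
    (∀ τ : CStarTrace Λ.CStar,
      Λ.IsGaugeInvariant τ → τ.IsSemifinite → τ.IsLowerSemicontinuous →
        (∀ a : {a : Λ.CStar // 0 ≤ a}, τ ⟨Λ.Phi a, Λ.Phi_nonneg a.2⟩ = τ a) ∧
        (∀ μ ν : Λ.Path,
          ∃ (h : Λ.gen μ.2.2 * star (Λ.gen ν.2.2) ∈ τ.extend.domain)
            (h' : Λ.vertexProj μ.1 ∈ τ.extend.domain),
            τ.extend ⟨Λ.gen μ.2.2 * star (Λ.gen ν.2.2), h⟩ =
              if μ = ν then τ.extend ⟨Λ.vertexProj μ.1, h'⟩ else 0) ∧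
        ((∀ a : {a : Λ.CStar // 0 ≤ a}, (a : Λ.CStar) ∈ Λ.diagonal → τ a = 0) →
          ∀ a : {a : Λ.CStar // 0 ≤ a}, τ a = 0)) :=
  ⟨fun ⟨_, hfaith, hsf⟩ _ f => KGraph.not_hasEntrance_of_trace hrow hconv hfaith hsf f,
    fun _ hinv hsf hlsc => ⟨fun a => KGraph.apply_Phi hrow hinv hsf hlsc a.2,
      KGraph.extend_gen_mul_star hrow hinv hsf, KGraph.eq_zero_of_forall_diagonal hrow hlsc⟩⟩
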